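/- **Setting.** All spaces $\mathbb R^d$ carry the Euclidean norm; $\overline{\mathbb R}=\mathbb R\cup\{+\infty\}$. Consider $$\min_{x\in\mathcal S}\ \frac{g(Ax)+h(x)}{f(Kx)},\tag{P}$$ with $\mathcal S\subseteq\mathbb R^n$, $f:\mathbb R^p\to\overline{\mathbb R}$, $g:\mathbb R^s\to\overline{\mathbb R}$, $h:\mathbb R^n\to\mathbb R$ and linear maps $A:\mathbb R^n\to\mathbb R^s$, $K:\mathbb R^n\to\mathbb R^p$ with adjoints $A^*,K^*$. Assume: * (Basic assumptions) $\mathcal S$ is nonempty, convex and compact; $f,g$ are proper, convex and lower semicontinuous; $h$ is differentiable with $L_{\nabla h}$-Lipschitz gradient on an open set containing $\mathcal S$; $K(\mathcal S)\subseteq\operatorname{int}(\operatorname{dom} f)$ and $f(Kx)>0$ for all $x\in\mathcal S$; $\mathcal S\cap A^{-1}(\operatorname{dom} g)\ne\emptyset$ and $\inf_{x\in\mathcal S}\{g(Ax)+h(x)\}>0$. * (Bounded subgradients) $A(\mathcal S)\subseteq\operatorname{dom}(\partial g)$ and there is $\ell>0$ with $\operatorname{dist}(0,\partial g(Ax))\le\ell$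 for all $x\in\mathcal S$. **Notation.** $\phi^*$ is the Fenchel conjugate of $\phi$, $\iota_{\mathcal S}$ is the indicator function of $\mathcal S$ ($0$ on $\mathcal S$, $+\infty$ off it), $\partial_{\epsilon}\phi(a)=\{v:\phi(w)\ge\phi(a)+\langle v,w-a\rangle-\epsilon\ \ \forall w\}$ for $a\in\operatorname{dom}\phi$ and $\partial\phi=\partial_0\phi$ for convex $\phi$, and $\operatorname{prox}_{\phi,\kappa}(w)=\arg\min_{v}\{\phi(v)+\frac1{2\kappa}\|v-w\|^2\}$. For the (nonconvex) merit functions $\Gamma,\Pi$ below, $\partial$ is the limiting subdifferential and $\operatorname{dom}\partial$ is the set where it is nonempty. The function $g$ is *essentially strictly convex* if it is strictly convex on every convex subset of $\operatorname{dom}(\partial g)$. A function $\phi$ is *calm* at $a\in\operatorname{dom}\phi$ if there are $r,c>0$ such that $\phi$ is finite and $|\phi(w)-\phi(a)|\le c\|w-a\|$ for all $w$ with $\|w-a\|<r$. A function $\phi$ has the *Kurdyka–Łojasiewicz (KL) property* at $a\in\operatorname{dom}\partial\phi$ if there are $\mu\in(0,+\infty]$, an open neighbourhood $U$ of $a$ and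 a continuous concave $\varphi:[0,\mu)\to[0,+\infty)$, continuously differentiable on $(0,\mu)$, with $\varphi(0)=0$ and $\varphi'>0$ on $(0,\mu)$, such that $\varphi'(\phi(w)-\phi(a))\operatorname{dist}(0,\partial\phi(w))\ge1$ for all $w\in U$ with $\phi(a)<\phi(w)<\phi(a)+\mu$ (where $\operatorname{dist}(0,\emptyset)=+\infty$). For $\epsilon_1,\epsilon_2\ge0$, a point $\bar x$ is a *limiting $(\epsilon_1,\epsilon_2)$-lifted stationary point* of (P) if there is $\overline\Psi\in\mathbb R$ with $|\overline\Psi-(g(A\bar x)+h(\bar x))|\le\epsilon_2$ and $$0\in\big(A^*\partial_{\epsilon_1}g(A\bar x)+\nabla h(\bar x)+\partial\iota_{\mathcal S}(\bar x)\big)f(K\bar x)-\overline\Psi\,K^*\partial f(K\bar x).$$ Put $\Psi(x,z,u,\delta,\gamma)=\langle z,Ax\rangle-g^*(z)+h(x)+\iota_{\mathcal S}(x)+\frac\delta2\|x-u\|^2-\frac\gamma2\|z\|^2$. **Algorithm (Adaptive FSPS).** Let $0<\beta<2$, $\nu>0$, $0<q<1$, $\delta_0,\theta_0>0$, $\gamma_0=1$,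 $\varepsilon>0$, $x^0\in\mathcal S$, $z^0\in\mathbb R^s$, $u^0\in\mathbb R^n$. For $k=0,1,2,\dots$: choose $y^{k+1}\in\partial f(Kx^k)$; set $$x^{k+1}=\operatorname{Proj}_{\mathcal S}\Big(u^k+\tfrac{\theta_k}{\delta_k}K^*y^{k+1}-\tfrac1{\delta_k}\nabla h(x^k)-\tfrac1{\delta_k}A^*z^k\Big),\qquad u^{k+1}=(1-\beta)u^k+\beta x^{k+1};$$ let $j_k$ be the smallest $j\in\{0,1,2,\dots\}$ such that, with $\gamma'=\gamma_kq^{j}$ and $z'=\operatorname{prox}_{g^*,1/\gamma'}(Ax^{k+1}/\gamma')$, one has $\theta':=\Psi(x^{k+1},z',u^{k+1},\delta_k,\gamma')/f(Kx^{k+1})>0$; for $j=j_k$ put $z^{k+1}=z'$, $\theta_{k+1}=\theta'$, and put $\gamma_{k+1}=\gamma'q$ if $\|z^{k+1}\|>\min\big(\varepsilon/\gamma',\sqrt{2\varepsilon/\gamma'}\big)$ and $\gamma_{k+1}=\gamma'$ otherwise; finally $\delta_{k+1}=2\nu+L_{\nabla h}+2\|A\|^2/\gamma_{k+1}$. **Merit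 functions.** Let $\gamma$ be the eventually constant value of $(\gamma_k)$ (under the two assumptions above, $(\gamma_k)$ is eventually constant), let $\delta=2\nu+L_{\nabla h}+2\|A\|^2/\gamma$, and let $m>0$ satisfy $m<f(Kx^k)$ for all $k\ge0$. Define $$\Gamma(x,y,z,u)=\frac{\Psi(x,z,u,\delta,\gamma)}{\langle Kx,y\rangle-f^*(y)}\ \text{ if } y\in\operatorname{dom}f^*,\ \langle Kx,y\rangle-f^*(y)>\tfrac m2,\ z\in\operatorname{dom}g^*,$$ $$\Pi(x,z,u)=\frac{\Psi(x,z,u,\delta,\gamma)}{f(Kx)}\ \text{ if } x\in\mathcal S,\ z\in\operatorname{dom}g^*,$$ and let both be $+\infty$ elsewhere. **Theorem (global convergence).** Let $\varepsilon>0$ and let the two assumptions above hold. Suppose that $K_\varepsilon:=\{w\in\mathbb R^s:\operatorname{dist}(w,A(\mathcal S))\le\varepsilon\}\subseteq\operatorname{int}(\operatorname{dom}g)$, that $g$ is essentially strictly convex, and that one of the following holds: * (i) $f^*$ is calm at every point of $\operatorname{dom}f^*$, and $\Gamma$ has the KL property at every point $(x,y,z,u)\in\operatorname{dom}\partial\Gamma$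 with $Ax\in K_\varepsilon$; * (ii) $f$ is (finite and) differentiable with Lipschitz continuous gradient on an open set containing $K(\mathcal S)$, and $\Pi$ has the KL property at every point $(x,z,u)\in\operatorname{dom}\partial\Pi$ with $Ax\in K_\varepsilon$. (The condition $Ax\in K_\varepsilon$ holds automatically at these points.) Let $\{(x^k,y^k,z^k,u^k)\}$ be generated by Adaptive FSPS. Then $$\sum_{k}\big(\|x^k-x^{k+1}\|+\|u^k-u^{k+1}\|+\|z^k-z^{k+1}\|\big)<+\infty,$$ the function $g$ is Lipschitz continuous on $K_\varepsilon$, and $\{x^k\}$ converges to a point that is, for every Lipschitz constant $\kappa$ of $g$ on $K_\varepsilon$, a limiting $(2\kappa\varepsilon,(2\kappa+1)\varepsilon)$-lifted stationary point of (P). In addition, if $g$ has full domain and is differentiable with $L_{\nabla g}$-Lipschitz continuous gradient ($L_{\nabla g}>0$), then this limit is a limiting $\big(\frac{L_{\nabla g}\varepsilon^2}{2},\frac{L_{\nabla g}\varepsilon^2}{2}+\varepsilon\big)$-lifted stationary point of (P). -/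

import Mathlib

open Filter Topology Set
open scoped NNReal ENNReal RealInnerProductSpace

noncomputable section

/-! Extended-real-valued functions `E → ℝ ∪ {+∞}` are modelled as functions `E → EReal` that are
required never to take the value `⊥`. -/

section ConvexAnalysis

variable {E : Type*} [NormedAddCommGroup E] [InnerProductSpace ℝ E]

/-- Effective domain. -/
def effDom (f : E → EReal) : Set E := {x | f x < ⊤}

/-- Proper function with values in `ℝ ∪ {+∞}`. -/
def IsProper (f : E → EReal) : Prop := (∀ x, f x ≠ ⊥) ∧ (effDom f).Nonempty

/-- Proper, convex and lower semicontinuous. As `f` is real-valued on its effective domain, convexity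
is convexity of the effective domain together with the usual inequality on it. -/
structure IsProperConvexLsc (f : E → EReal) : Prop where
  proper : IsProper f
  convex : ConvexOn ℝ (effDom f) (fun x => (f x).toReal)
  lsc : LowerSemicontinuous f

/-- Fenchel conjugate `f*(v) = sup_x (⟨v, x⟩ - f x)`. -/
def fenchelConj (f : E → EReal) (v : E) : EReal := ⨆ x : E, ((⟪v, x⟫ : ℝ) : EReal) - f x

/-- The `ε`-subdifferential of convex analysis; empty off the effective domain. -/
def epsSubdiff (ε : ℝ) (f : E → EReal) (a : E) : Set E :=
  {v | a ∈ effDom f ∧ ∀ x, f a + ((⟪v, x - a⟫ - ε : ℝ) : EReal) ≤ f x}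

/-- The convex subdifferential, i.e. the `0`-subdifferential. -/
def convSubdiff (f : E → EReal) (a : E) : Set E := epsSubdiff 0 f a

/-- Domain of the convex subdifferential. -/
def domConvSubdiff (f : E → EReal) : Set E := {a | (convSubdiff f a).Nonempty}

open Classical in
/-- Indicator function of a set: `0` on the set and `+∞` off it. -/
def indicatorFn (C : Set E) (x : E) : EReal := if x ∈ C then 0 else ⊤

/-- Fréchet subdifferential: `v` such that
`liminf_{x → a, x ≠ a} (f x - f a - ⟨v, x - a⟩) / ‖x - a‖ ≥ 0`, the `liminf` being spelled out;
empty off the effective domain. -/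
def frechetSubdiff (f : E → EReal) (a : E) : Set E :=
  {v | f a ≠ ⊥ ∧ a ∈ effDom f ∧
    ∀ η : ℝ, 0 < η → ∀ᶠ x in 𝓝 a, f a + ((⟪v, x - a⟫ - η * ‖x - a‖ : ℝ) : EReal) ≤ f x}

/-- Limiting subdifferential; empty off the effective domain. -/
def limitingSubdiff (f : E → EReal) (a : E) : Set E :=
  {v | f a ≠ ⊥ ∧ a ∈ effDom f ∧ ∃ (x : ℕ → E) (w : ℕ → E),
    Tendsto x atTop (𝓝 a) ∧ Tendsto (fun k => f (x k)) atTop (𝓝 (f a)) ∧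
    Tendsto w atTop (𝓝 v) ∧ ∀ k, w k ∈ frechetSubdiff f (x k)}

/-- Domain of the limiting subdifferential. -/
def domLimitingSubdiff (f : E → EReal) : Set E := {a | (limitingSubdiff f a).Nonempty}

/-- `y = prox_{f, κ}(x)`, i.e. `y` minimizes `f + (1 / (2 κ)) ‖· - x‖²`. -/
def IsProx (f : E → EReal) (κ : ℝ) (x y : E) : Prop :=
  ∀ y', f y + ((1 / (2 * κ) * ‖y - x‖ ^ 2 : ℝ) : EReal) ≤
    f y' + ((1 / (2 * κ) * ‖y' - x‖ ^ 2 : ℝ) : EReal)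

/-- `y` is the projection of `x` onto `C`. -/
def IsProj (C : Set E) (x y : E) : Prop := y ∈ C ∧ ∀ y' ∈ C, ‖x - y‖ ≤ ‖x - y'‖

/-- Essentially strictly convex: strictly convex on every convex subset of the domain of the
subdifferential. -/
def IsEssStrictConvex (f : E → EReal) : Prop :=
  IsProper f ∧ ∀ C : Set E, Convex ℝ C → C ⊆ domConvSubdiff f →
    StrictConvexOn ℝ C (fun x => (f x).toReal)

/-- Calmness at a point: `|f y - f a| ≤ κ ‖y - a‖` on a ball around `a`; in particular `f` is finite
on this ball. -/
def IsCalmAt (f : E → EReal) (a : E) : Prop :=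
  a ∈ effDom f ∧ ∃ ε > (0 : ℝ), ∃ κ > (0 : ℝ), ∀ y, ‖y - a‖ < ε →
    y ∈ effDom f ∧ |(f y).toReal - (f a).toReal| ≤ κ * ‖y - a‖

/-- Kurdyka-Łojasiewicz property at a point `a` of the domain of the limiting subdifferential. The
distance to the empty set is `∞`. -/
def HasKLAt (f : E → EReal) (a : E) : Prop :=
  a ∈ domLimitingSubdiff f ∧
  ∃ (μ : EReal) (U : Set E) (φ : ℝ → ℝ), 0 < μ ∧ IsOpen U ∧ a ∈ U ∧
    (∀ t : ℝ, 0 ≤ t → (t : EReal) < μ → 0 ≤ φ t) ∧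
    ContinuousOn φ {t : ℝ | 0 ≤ t ∧ (t : EReal) < μ} ∧
    ConcaveOn ℝ {t : ℝ | 0 ≤ t ∧ (t : EReal) < μ} φ ∧
    DifferentiableOn ℝ φ {t : ℝ | 0 < t ∧ (t : EReal) < μ} ∧
    ContinuousOn (deriv φ) {t : ℝ | 0 < t ∧ (t : EReal) < μ} ∧
    φ 0 = 0 ∧
    (∀ t : ℝ, 0 < t → (t : EReal) < μ → 0 < deriv φ t) ∧
    ∀ x ∈ U, f a < f x → f x < f a + μ →
      1 ≤ ENNReal.ofReal (deriv φ ((f x).toReal - (f a).toReal)) *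
        Metric.infEDist 0 (limitingSubdiff f x)

/-- `f` is finite and differentiable with Lipschitz continuous gradient on an open set that
contains `C`. -/
def HasLipschitzGradientNear [CompleteSpace E] (f : E → EReal) (C : Set E) : Prop :=
  ∃ (O : Set E) (L : ℝ≥0), IsOpen O ∧ C ⊆ O ∧ (∀ x ∈ O, f x ≠ ⊤ ∧ f x ≠ ⊥) ∧
    DifferentiableOn ℝ (fun x => (f x).toReal) O ∧
    LipschitzOnWith L (gradient (fun x => (f x).toReal)) O

end ConvexAnalysis

/-- `ℝⁿ` with the Euclidean norm. -/
abbrev Eucl (n : ℕ) := EuclideanSpace ℝ (Fin n)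

/-- The data of the fractional program `min_{x ∈ S} (g (A x) + h x) / f (K x)`. -/
structure FracProgram (n p s : ℕ) where
  S : Set (Eucl n)
  f : Eucl p → EReal
  g : Eucl s → EReal
  h : Eucl n → ℝ
  A : Eucl n →L[ℝ] Eucl s
  K : Eucl n →L[ℝ] Eucl p

namespace FracProgram

variable {n p s : ℕ} (P : FracProgram n p s)

/-- The adjoint of `A`. -/
def Aadj : Eucl s →L[ℝ] Eucl n := ContinuousLinearMap.adjoint P.A

/-- The adjoint of `K`. -/
def Kadj : Eucl p →L[ℝ] Eucl n := ContinuousLinearMap.adjoint P.K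

/-- The basic assumptions on the fractional program; `L` is the Lipschitz constant of `∇h`. -/
structure BasicAssumptions (L : ℝ≥0) : Prop where
  S_nonempty : P.S.Nonempty
  S_convex : Convex ℝ P.S
  S_compact : IsCompact P.S
  g_pcl : IsProperConvexLsc P.g
  h_smooth : ∃ O : Set (Eucl n), IsOpen O ∧ P.S ⊆ O ∧ DifferentiableOn ℝ P.h O ∧
    LipschitzOnWith L (gradient P.h) O
  f_pcl : IsProperConvexLsc P.f
  KS_subset : P.K '' P.S ⊆ interior (effDom P.f)
  f_pos : ∀ x ∈ P.S, 0 < P.f (P.K x)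
  feasible : (P.S ∩ P.A ⁻¹' effDom P.g).Nonempty
  inf_pos : 0 < ⨅ x ∈ P.S, P.g (P.A x) + (P.h x : EReal)

/-- `A(S) ⊆ dom ∂g` and `∂g` has uniformly bounded minimal norm on `A(S)`. -/
def SubgradientBound : Prop :=
  P.A '' P.S ⊆ domConvSubdiff P.g ∧
    ∃ l > (0 : ℝ), ∀ x ∈ P.S, Metric.infDist 0 (convSubdiff P.g (P.A x)) ≤ l

/-- The closed `ε`-neighbourhood `K_ε` of `A(S)`. -/
def Keps (ε : ℝ) : Set (Eucl s) := {w | Metric.infDist w (P.A '' P.S) ≤ ε}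

/-- The augmented function
`Ψ(x, z, u, δ, γ) = ⟨z, A x⟩ - g*(z) + h(x) + ι_S(x) + (δ/2) ‖x - u‖² - (γ/2) ‖z‖²`
on `S × dom g* × ℝⁿ`, where it is real-valued (with `ι_S(x) = 0`); it is only used there. -/
def Psi (x : Eucl n) (z : Eucl s) (u : Eucl n) (δ γ : ℝ) : ℝ :=
  ⟪z, P.A x⟫ - (fenchelConj P.g z).toReal + P.h x + δ / 2 * ‖x - u‖ ^ 2 - γ / 2 * ‖z‖ ^ 2

/-- `ℝⁿ × ℝˢ × ℝⁿ` with the Euclidean norm. -/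
abbrev Triples (n s : ℕ) := WithLp 2 (Eucl n × WithLp 2 (Eucl s × Eucl n))

/-- `ℝⁿ × ℝᵖ × ℝˢ × ℝⁿ` with the Euclidean norm. -/
abbrev Quadruples (n p s : ℕ) := WithLp 2 (Eucl n × WithLp 2 (Eucl p × WithLp 2 (Eucl s × Eucl n)))

open Classical in
/-- The merit function `Π(x, z, u) = Ψ(x, z, u, δ, γ) / f(K x)`, equal to `+∞` off
`S × dom g* × ℝⁿ`. -/
def PiMerit (δ γ : ℝ) (w : Triples n s) : EReal :=
  let x := w.fst
  let z := w.snd.fst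
  let u := w.snd.snd
  if x ∈ P.S ∧ z ∈ effDom (fenchelConj P.g) then
    ((P.Psi x z u δ γ / (P.f (P.K x)).toReal : ℝ) : EReal)
  else ⊤

open Classical in
/-- The merit function `Γ(x, y, z, u) = Ψ(x, z, u, δ, γ) / (⟨K x, y⟩ - f*(y))` on the set of all
`(x, y, z, u)` with `y ∈ dom f*`, `⟨K x, y⟩ - f*(y) > m / 2` and `z ∈ dom g*`; it is `+∞` if
`x ∉ S`, as `Ψ` is, and off this set. -/
def GammaMerit (m δ γ : ℝ) (w : Quadruples n p s) : EReal :=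
  let x := w.fst
  let y := w.snd.fst
  let z := w.snd.snd.fst
  let u := w.snd.snd.snd
  if x ∈ P.S ∧ y ∈ effDom (fenchelConj P.f) ∧
      m / 2 < ⟪P.K x, y⟫ - (fenchelConj P.f y).toReal ∧ z ∈ effDom (fenchelConj P.g) then
    ((P.Psi x z u δ γ / (⟪P.K x, y⟫ - (fenchelConj P.f y).toReal) : ℝ) : EReal)
  else ⊤

/-- Limiting `(ε₁, ε₂)`-lifted stationary point: there is `ψ ∈ ℝ` with
`|ψ - (g(A x) + h(x))| ≤ ε₂` and
`0 ∈ (A* ∂_{ε₁} g(A x) + ∇h(x) + ∂ι_S(x)) f(K x) - ψ K* ∂f(K x)`. -/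
def IsLiftedStationary (ε₁ ε₂ : ℝ) (x : Eucl n) : Prop :=
  ∃ ψ : ℝ, |ψ - ((P.g (P.A x)).toReal + P.h x)| ≤ ε₂ ∧
    ∃ a ∈ epsSubdiff ε₁ P.g (P.A x), ∃ c ∈ convSubdiff (indicatorFn P.S) x,
      ∃ b ∈ convSubdiff P.f (P.K x),
        0 = (P.f (P.K x)).toReal • (P.Aadj a + gradient P.h x + c) - ψ • P.Kadj b

/-- The sequences `x, y, z, u, θ, γ, δ` are generated by the adaptive full-splitting proximal
subgradient algorithm with parameters `β, ν, q, ε`, where `L` is the Lipschitz constant of `∇h`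
(the value of `y 0` is irrelevant). In step `k`, `j` is the smallest number of backtracking
reductions of `γ k` by the factor `q` that makes the new `θ` positive, and `γ'` is the value of `γ`
after these reductions; it is reduced once more if `‖z (k + 1)‖` is too large. -/
structure IsAdaptiveFSPS (L : ℝ≥0) (β ν q ε : ℝ) (x : ℕ → Eucl n) (y : ℕ → Eucl p)
    (z : ℕ → Eucl s) (u : ℕ → Eucl n) (θ γ δ : ℕ → ℝ) : Prop where
  x_zero : x 0 ∈ P.S
  θ_zero : 0 < θ 0
  γ_zero : γ 0 = 1
  δ_zero : 0 < δ 0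
  y_step : ∀ k, y (k + 1) ∈ convSubdiff P.f (P.K (x k))
  x_step : ∀ k, IsProj P.S
    (u k + (θ k / δ k) • P.Kadj (y (k + 1)) - (1 / δ k) • gradient P.h (x k)
      - (1 / δ k) • P.Aadj (z k)) (x (k + 1))
  u_step : ∀ k, u (k + 1) = (1 - β) • u k + β • x (k + 1)
  z_step : ∀ k, ∃ (j : ℕ) (γ' : ℝ), γ' = γ k * q ^ j ∧
    IsLeast {i : ℕ | ∃ w : Eucl s,
      IsProx (fenchelConj P.g) (1 / (γ k * q ^ i)) ((1 / (γ k * q ^ i)) • P.A (x (k + 1))) w ∧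
      0 < P.Psi (x (k + 1)) w (u (k + 1)) (δ k) (γ k * q ^ i) /
        (P.f (P.K (x (k + 1)))).toReal} j ∧
    IsProx (fenchelConj P.g) (1 / γ') ((1 / γ') • P.A (x (k + 1))) (z (k + 1)) ∧
    θ (k + 1) = P.Psi (x (k + 1)) (z (k + 1)) (u (k + 1)) (δ k) γ' /
      (P.f (P.K (x (k + 1)))).toReal ∧
    γ (k + 1) = if min (ε / γ') (√(2 * ε / γ')) < ‖z (k + 1)‖ then γ' * q else γ'
  δ_step : ∀ k, δ (k + 1) = 2 * ν + L + 2 * ‖P.A‖ ^ 2 / γ (k + 1)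

end FracProgram

end

/-! ### Convex analysis: subgradients, conjugates and smoothing of the conjugate. -/

section ConvexAnalysisLemmas

variable {E : Type*} [NormedAddCommGroup E] [InnerProductSpace ℝ E] {f : E → EReal}

/-! The dual step maximizes ⟨z, Ax⟩ - g*(z) - (γ/2)‖z‖², whose value is the Moreau envelope of `g`
at `Ax`; its maximizer is characterized by z ∈ ∂g(Ax - γz). Monotonicity of ∂g bounds ‖z‖ by the
norm of any subgradient at `Ax`, so under the bounded subgradient assumption a small enough γ passes
both tests of the algorithm. Hence γ freezes (`exists_γ_eventually_eq`), and a tail of the iterates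
has constant parameters (`steadyFSPS_tail`).

On this tail let a_k be the sum of the lengths of the steps in x, u and z, and D_k the linearization
of f ∘ K at x_k, evaluated at x_{k+1}. The projection inequality, the descent lemma for `h` and
strong concavity in z give Ψ_{k+1} + c a_k² ≤ θ_k D_k (`psi_succ_le`, `exists_descent`). As D_k ≤
f(Kx_{k+1}), the ratios θ_k decrease by at least a multiple of a_k².

Essential strict convexity of `g` makes g* differentiable at each z ∈ ∂g(w), with gradient w
(`hasGradientAt_fenchelConj`). With w = Ax - γz the z-derivative of Ψ vanishes, and the other
components of a Fréchet subgradient of the merit function are bounded by a_k plus the decrease of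
the merit values. For Π this uses the Lipschitz gradient of `f`. For Γ it uses instead that, by
Fenchel–Young, the denominator of Γ lies below a smooth function of (x, y) and touches it at the
iterate, so Γ has a smooth local minorant on its domain. The values of Γ along the iterates are
Ψ_{k+1}/D_k, squeezed between θ_{k+1} and θ_k.

Sufficient decrease, the subgradient bound and the KL property at cluster points give finite length
(`summable_of_hasKLAt`). The iterates therefore converge, and the optimality conditions pass to the
limit. There z is a subgradient of `g` at Ax - γz, a point within ε of `Ax`, hence an approximate
subgradient at `Ax`; the error g(Ax) - g(Ax - γz) - γ‖z‖² is estimated by Lipschitz continuity of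
`g` or of its gradient (`isLiftedStationary`). -/

omit [NormedAddCommGroup E] [InnerProductSpace ℝ E] in
lemma IsProper.coe_toReal (hf : IsProper f) {x : E} (hx : x ∈ effDom f) :
    ((f x).toReal : EReal) = f x :=
  EReal.coe_toReal (ne_of_lt hx) (hf.1 x)

omit [NormedAddCommGroup E] [InnerProductSpace ℝ E] in
lemma mem_effDom_of_eq_coe {x : E} {r : ℝ} (h : f x = r) : x ∈ effDom f := by
  change f x < ⊤
  rw [h]
  exact EReal.coe_lt_top r

lemma IsProper.subgradient_le (hf : IsProper f) {a v x : E} (hv : v ∈ convSubdiff f a)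
    (hx : x ∈ effDom f) : (f a).toReal + ⟪v, x - a⟫ ≤ (f x).toReal := by
  have h := hv.2 x
  rw [← hf.coe_toReal hx, ← hf.coe_toReal hv.1, ← EReal.coe_add, EReal.coe_le_coe_iff] at h
  linarith

lemma IsProper.mem_epsSubdiff (hf : IsProper f) {ε : ℝ} {a v : E} (ha : a ∈ effDom f)
    (h : ∀ x ∈ effDom f, (f a).toReal + ⟪v, x - a⟫ - ε ≤ (f x).toReal) : v ∈ epsSubdiff ε f a := by
  refine ⟨ha, fun x => ?_⟩
  by_cases hx : x ∈ effDom f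
  · rw [← hf.coe_toReal hx, ← hf.coe_toReal ha, ← EReal.coe_add, EReal.coe_le_coe_iff]
    linarith [h x hx]
  · have : f x = ⊤ := not_lt_top_iff.mp hx
    rw [this]
    exact le_top

lemma IsProper.mem_convSubdiff (hf : IsProper f) {a v : E} (ha : a ∈ effDom f)
    (h : ∀ x ∈ effDom f, (f a).toReal + ⟪v, x - a⟫ ≤ (f x).toReal) : v ∈ convSubdiff f a :=
  hf.mem_epsSubdiff ha fun x hx => by simpa using h x hx

lemma IsProper.inner_sub_nonneg (hf : IsProper f) {a b v w : E} (hv : v ∈ convSubdiff f a)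
    (hw : w ∈ convSubdiff f b) : 0 ≤ ⟪v - w, a - b⟫ := by
  have h1 := hf.subgradient_le hv hw.1
  have h2 := hf.subgradient_le hw hv.1
  have h3 : ⟪v, b - a⟫ = -⟪v, a - b⟫ := by rw [← inner_neg_right, neg_sub]
  rw [inner_sub_left]
  linarith

/-! ### Conjugates -/

lemma IsProper.fenchelConj_ne_bot (hf : IsProper f) (z : E) : fenchelConj f z ≠ ⊥ := by
  obtain ⟨x, hx⟩ := hf.2
  have h : ((⟪z, x⟫ : ℝ) : EReal) - f x ≤ fenchelConj f z :=
    le_iSup (fun x => ((⟪z, x⟫ : ℝ) : EReal) - f x) x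
  rw [← hf.coe_toReal hx, ← EReal.coe_sub] at h
  exact ne_of_gt (lt_of_lt_of_le (EReal.bot_lt_coe _) h)

lemma IsProper.fenchelConj_coe_toReal (hf : IsProper f) {z : E} (hz : z ∈ effDom (fenchelConj f)) :
    ((fenchelConj f z).toReal : EReal) = fenchelConj f z :=
  EReal.coe_toReal (ne_of_lt hz) (hf.fenchelConj_ne_bot z)

lemma IsProper.le_fenchelConj (hf : IsProper f) {x : E} (hx : x ∈ effDom f) (z : E) :
    ((⟪z, x⟫ - (f x).toReal : ℝ) : EReal) ≤ fenchelConj f z := by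
  rw [EReal.coe_sub, hf.coe_toReal hx]
  exact le_iSup (fun x => ((⟪z, x⟫ : ℝ) : EReal) - f x) x

lemma IsProper.le_fenchelConj_toReal (hf : IsProper f) {x z : E} (hx : x ∈ effDom f)
    (hz : z ∈ effDom (fenchelConj f)) : ⟪z, x⟫ - (f x).toReal ≤ (fenchelConj f z).toReal := by
  have h := hf.le_fenchelConj hx z
  rwa [← hf.fenchelConj_coe_toReal hz, EReal.coe_le_coe_iff] at h

lemma IsProper.fenchelConj_le (hf : IsProper f) {z : E} {r : ℝ}
    (h : ∀ x ∈ effDom f, ⟪z, x⟫ - (f x).toReal ≤ r) : fenchelConj f z ≤ r := by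
  refine iSup_le fun x => ?_
  by_cases hx : x ∈ effDom f
  · rw [← hf.coe_toReal hx, ← EReal.coe_sub, EReal.coe_le_coe_iff]
    exact h x hx
  · have : f x = ⊤ := not_lt_top_iff.mp hx
    rw [this, EReal.sub_top]
    exact bot_le

lemma IsProper.fenchelConj_eq (hf : IsProper f) {w z : E} (hz : z ∈ convSubdiff f w) :
    fenchelConj f z = ((⟪z, w⟫ - (f w).toReal : ℝ) : EReal) := by
  refine le_antisymm (hf.fenchelConj_le fun x hx => ?_) (hf.le_fenchelConj hz.1 z)
  have := hf.subgradient_le hz hx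
  rw [inner_sub_right] at this
  linarith

lemma IsProper.fenchelConj_toReal (hf : IsProper f) {w z : E} (hz : z ∈ convSubdiff f w) :
    (fenchelConj f z).toReal = ⟪z, w⟫ - (f w).toReal := by
  rw [hf.fenchelConj_eq hz, EReal.toReal_coe]

lemma IsProper.mem_effDom_fenchelConj (hf : IsProper f) {w z : E} (hz : z ∈ convSubdiff f w) :
    z ∈ effDom (fenchelConj f) :=
  mem_effDom_of_eq_coe (hf.fenchelConj_eq hz)

/-! ### Closedness of the graph of the subdifferential -/

/-- The subgradient inequality tested at a fixed v bounds the values from above, and lower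
semicontinuity bounds them from below. Testing at the limit point itself yields convergence of the
values, although `f` is only lower semicontinuous. -/
lemma IsProperConvexLsc.mem_convSubdiff_of_tendsto (hf : IsProperConvexLsc f) {ι : Type*}
    {l : Filter ι} [l.NeBot] {w z : ι → E} {w₀ z₀ : E} (hz : ∀ i, z i ∈ convSubdiff f (w i))
    (hw₀ : Tendsto w l (𝓝 w₀)) (hz₀ : Tendsto z l (𝓝 z₀)) :
    z₀ ∈ convSubdiff f w₀ ∧ Tendsto (fun i => (f (w i)).toReal) l (𝓝 (f w₀).toReal) := by
  have hp := hf.proper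
  have upper : ∀ v ∈ effDom f, ∀ η > 0,
      ∀ᶠ i in l, (f (w i)).toReal < (f v).toReal - ⟪z₀, v - w₀⟫ + η := by
    intro v hv η hη
    have ht : Tendsto (fun i => (f v).toReal - ⟪z i, v - w i⟫) l
        (𝓝 ((f v).toReal - ⟪z₀, v - w₀⟫)) :=
      tendsto_const_nhds.sub (hz₀.inner (tendsto_const_nhds.sub hw₀))
    filter_upwards [ht.eventually_lt_const (lt_add_of_pos_right _ hη)] with i hi
    linarith [hp.subgradient_le (hz i) hv]
  have lower : ∀ r : ℝ, (r : EReal) < f w₀ → ∀ᶠ i in l, r < (f (w i)).toReal := by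
    intro r hr
    filter_upwards [hw₀.eventually (hf.lsc w₀ r hr)] with i hi
    rwa [← hp.coe_toReal (hz i).1, gt_iff_lt, EReal.coe_lt_coe_iff] at hi
  have hdom : w₀ ∈ effDom f := by
    by_contra hw
    have htop : f w₀ = ⊤ := not_lt_top_iff.mp hw
    obtain ⟨v, hv⟩ := hp.2
    obtain ⟨i, hi, hi'⟩ := ((upper v hv 1 one_pos).and
      (lower ((f v).toReal - ⟪z₀, v - w₀⟫ + 1) (by rw [htop]; exact EReal.coe_lt_top _))).exists
    linarith
  refine ⟨hp.mem_convSubdiff hdom fun v hv => ?_, ?_⟩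
  · by_contra! hcon
    set η := ((f w₀).toReal + ⟪z₀, v - w₀⟫ - (f v).toReal) / 2 with hη
    obtain ⟨i, hi, hi'⟩ := ((upper v hv η (by linarith)).and
      (lower ((f v).toReal - ⟪z₀, v - w₀⟫ + η) (by
        rw [← hp.coe_toReal hdom, EReal.coe_lt_coe_iff]; linarith))).exists
    linarith
  · refine tendsto_order.2 ⟨fun r hr => lower r ?_, fun r hr => ?_⟩
    · rwa [← hp.coe_toReal hdom, EReal.coe_lt_coe_iff]
    · filter_upwards [upper w₀ hdom (r - (f w₀).toReal) (by linarith)] with i hi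
      simp only [sub_self, inner_zero_right] at hi
      linarith

/-! ### The proximal map of the conjugate -/

/-- Moreau's decomposition: if p is the proximal point of `f` at a, then z = (a - p)/γ. The prox of
the conjugate is thus obtained from a primal minimization, without biconjugation. -/
lemma IsProperConvexLsc.exists_mem_convSubdiff_sub_smul [ProperSpace E] (hf : IsProperConvexLsc f)
    {a v : E} (hv : v ∈ convSubdiff f a) {γ : ℝ} (hγ : 0 < γ) :
    ∃ z, z ∈ convSubdiff f (a - γ • z) := by
  have hp := hf.proper
  set F : E → EReal := fun x => f x + ((1 / (2 * γ) * ‖x - a‖ ^ 2 : ℝ) : EReal) with hF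
  have hlsc : LowerSemicontinuous F := by
    intro x
    refine LowerSemicontinuousAt.add' (hf.lsc x) ?_ ?_
    · exact (continuous_coe_real_ereal.comp (by fun_prop)).continuousAt.lowerSemicontinuousAt
    · exact EReal.continuousAt_add (Or.inr (EReal.coe_ne_bot _)) (Or.inr (EReal.coe_ne_top _))
  -- Beyond this radius the quadratic term dominates the linear lower bound given by v, so the
  -- objective is at least its value at a and minimizing over the ball suffices.
  have hR : 0 ≤ 2 * γ * ‖v‖ := by positivity
  obtain ⟨p, hpm, hmin⟩ := (hlsc.lowerSemicontinuousOn
    (Metric.closedBall a (2 * γ * ‖v‖))).exists_isMinOn ⟨a, Metric.mem_closedBall_self hR⟩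
    (isCompact_closedBall a _)
  have hFa : F a = f a := by simp [hF]
  have hle : ∀ x, F p ≤ F x := by
    intro x
    by_cases hx : x ∈ Metric.closedBall a (2 * γ * ‖v‖)
    · exact hmin hx
    · refine (hmin (Metric.mem_closedBall_self hR)).trans ?_
      by_cases hxd : x ∈ effDom f
      · have h1 := hp.subgradient_le hv hxd
        have hcs := neg_le_of_abs_le (abs_real_inner_le_norm v (x - a))
        rw [hFa, hF]
        simp only
        rw [← hp.coe_toReal hxd, ← hp.coe_toReal hv.1, ← EReal.coe_add, EReal.coe_le_coe_iff]
        rw [Metric.mem_closedBall, dist_eq_norm, not_le] at hx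
        have h2 : ‖v‖ * ‖x - a‖ ≤ 1 / (2 * γ) * ‖x - a‖ ^ 2 := by
          have : ‖v‖ ≤ 1 / (2 * γ) * ‖x - a‖ := by
            rw [div_mul_eq_mul_div, le_div_iff₀ (by positivity)]
            linarith
          nlinarith [norm_nonneg (x - a)]
        linarith
      · have : f x = ⊤ := not_lt_top_iff.mp hxd
        rw [hF]
        simp only
        rw [this, EReal.top_add_coe]
        exact le_top
  have hpd : p ∈ effDom f := by
    have h1 := hle a
    rw [hFa] at h1
    by_contra hc
    have : f p = ⊤ := not_lt_top_iff.mp hc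
    have h2 : F p = ⊤ := by
      rw [hF]
      simp only
      rw [this, EReal.top_add_coe]
    rw [h2] at h1
    exact absurd hv.1 (not_lt_top_iff.mpr (top_le_iff.mp h1))
  refine ⟨(1 / γ) • (a - p), ?_⟩
  have hpeq : a - γ • (1 / γ) • (a - p) = p := by
    rw [smul_smul, mul_one_div_cancel hγ.ne', one_smul, sub_sub_cancel]
  rw [hpeq]
  refine hp.mem_convSubdiff hpd fun x hx => ?_
  -- Minimality of p is compared with the point p + t(x - p) and divided by t; the quadratic
  -- remainder disappears as t → 0.
  have key : ∀ t : ℝ, 0 < t → t ≤ 1 →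
      (f p).toReal + ⟪(1 / γ) • (a - p), x - p⟫ ≤ (f x).toReal + t * (1 / (2 * γ) * ‖x - p‖ ^ 2) := by
    intro t ht ht1
    have hmem : (1 - t) • p + t • x ∈ effDom f :=
      hf.convex.1 hpd hx (by linarith) ht.le (by ring)
    have hcv := hf.convex.2 hpd hx (by linarith : 0 ≤ 1 - t) ht.le (by ring)
    have h1 := hle ((1 - t) • p + t • x)
    simp only [hF] at h1
    rw [← hp.coe_toReal hpd, ← hp.coe_toReal hmem, ← EReal.coe_add, ← EReal.coe_add,
      EReal.coe_le_coe_iff] at h1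
    have hexp : ‖(1 - t) • p + t • x - a‖ ^ 2
        = ‖p - a‖ ^ 2 - 2 * t * ⟪a - p, x - p⟫ + t ^ 2 * ‖x - p‖ ^ 2 := by
      have : (1 - t) • p + t • x - a = (p - a) + t • (x - p) := by module
      rw [this, norm_add_sq_real, inner_smul_right, norm_smul, mul_pow, Real.norm_eq_abs, sq_abs,
        ← neg_sub a p, inner_neg_left]
      ring
    rw [hexp] at h1
    simp only [smul_eq_mul] at hcv
    rw [real_inner_smul_left]
    have h2 : 0 ≤ t * ((f x).toReal + t * (1 / (2 * γ) * ‖x - p‖ ^ 2)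
        - ((f p).toReal + 1 / γ * ⟪a - p, x - p⟫)) := by
      have : 1 / γ = 2 * (1 / (2 * γ)) := by field_simp
      rw [this]
      nlinarith
    have := nonneg_of_mul_nonneg_right h2 ht
    linarith
  have ht : Tendsto (fun t : ℝ => (f x).toReal + t * (1 / (2 * γ) * ‖x - p‖ ^ 2)) (𝓝[>] 0)
      (𝓝 ((f x).toReal + 0 * (1 / (2 * γ) * ‖x - p‖ ^ 2))) :=
    ((tendsto_const_nhds.add (tendsto_id.mul_const _)).mono_left nhdsWithin_le_nhds)
  rw [zero_mul, add_zero] at ht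
  refine ge_of_tendsto ht ?_
  filter_upwards [Ioc_mem_nhdsGT (zero_lt_one' ℝ)] with t ht
  exact key t ht.1 ht.2

lemma prox_objective_expand (a z : E) {γ : ℝ} (hγ : 0 < γ) (c : ℝ) :
    c + 1 / (2 * (1 / γ)) * ‖z - (1 / γ) • a‖ ^ 2
      = c - ⟪z, a⟫ + γ / 2 * ‖z‖ ^ 2 + 1 / (2 * γ) * ‖a‖ ^ 2 := by
  rw [norm_sub_sq_real, inner_smul_right, norm_smul, mul_pow, Real.norm_eq_abs, sq_abs]
  field_simp
  ring

/-- The smoothed dual objective is γ-strongly concave and z is its maximizer. This gives uniqueness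
of the prox and the decrease in z of the algorithm. -/
lemma IsProper.sub_sq_le_of_mem_convSubdiff (hf : IsProper f) {a z z' : E} {γ : ℝ}
    (hz : z ∈ convSubdiff f (a - γ • z)) (hz' : z' ∈ effDom (fenchelConj f)) :
    ⟪z', a⟫ - (fenchelConj f z').toReal - γ / 2 * ‖z'‖ ^ 2 ≤
      ⟪z, a⟫ - (fenchelConj f z).toReal - γ / 2 * ‖z‖ ^ 2 - γ / 2 * ‖z' - z‖ ^ 2 := by
  have h1 := hf.le_fenchelConj_toReal hz.1 hz'
  have h2 := hf.fenchelConj_toReal hz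
  rw [inner_sub_right, inner_smul_right] at h1 h2
  rw [real_inner_self_eq_norm_sq] at h2
  rw [norm_sub_sq_real]
  nlinarith

lemma IsProper.isProx_of_mem_convSubdiff (hf : IsProper f) {a z : E} {γ : ℝ} (hγ : 0 < γ)
    (hz : z ∈ convSubdiff f (a - γ • z)) : IsProx (fenchelConj f) (1 / γ) ((1 / γ) • a) z := by
  intro z'
  by_cases hz' : z' ∈ effDom (fenchelConj f)
  · rw [← hf.fenchelConj_coe_toReal hz', ← hf.fenchelConj_coe_toReal (hf.mem_effDom_fenchelConj hz),
      ← EReal.coe_add, ← EReal.coe_add, EReal.coe_le_coe_iff, prox_objective_expand a z hγ,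
      prox_objective_expand a z' hγ]
    have h1 := hf.sub_sq_le_of_mem_convSubdiff hz hz'
    have : 0 ≤ γ / 2 * ‖z' - z‖ ^ 2 := by positivity
    linarith
  · have : fenchelConj f z' = ⊤ := not_lt_top_iff.mp hz'
    rw [this, EReal.top_add_coe]
    exact le_top

lemma IsProper.eq_of_isProx (hf : IsProper f) {a z z' : E} {γ : ℝ} (hγ : 0 < γ)
    (hz : z ∈ convSubdiff f (a - γ • z))
    (hz' : IsProx (fenchelConj f) (1 / γ) ((1 / γ) • a) z') : z' = z := by
  have hzd := hf.mem_effDom_fenchelConj hz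
  have h := hz' z
  have hzd' : z' ∈ effDom (fenchelConj f) := by
    by_contra hc
    have : fenchelConj f z' = ⊤ := not_lt_top_iff.mp hc
    rw [this, EReal.top_add_coe, ← hf.fenchelConj_coe_toReal hzd, ← EReal.coe_add, top_le_iff] at h
    exact EReal.coe_ne_top _ h
  rw [← hf.fenchelConj_coe_toReal hzd', ← hf.fenchelConj_coe_toReal hzd, ← EReal.coe_add,
    ← EReal.coe_add, EReal.coe_le_coe_iff, prox_objective_expand a z hγ,
    prox_objective_expand a z' hγ] at h
  have h1 := hf.sub_sq_le_of_mem_convSubdiff hz hzd'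
  have h2 : ‖z' - z‖ ^ 2 ≤ 0 := by nlinarith
  have h3 : ‖z' - z‖ = 0 := by nlinarith [norm_nonneg (z' - z)]
  exact sub_eq_zero.mp (norm_eq_zero.mp h3)

lemma IsProperConvexLsc.mem_convSubdiff_of_isProx [ProperSpace E] (hf : IsProperConvexLsc f)
    {a v z : E} (hv : v ∈ convSubdiff f a) {γ : ℝ} (hγ : 0 < γ)
    (hz : IsProx (fenchelConj f) (1 / γ) ((1 / γ) • a) z) : z ∈ convSubdiff f (a - γ • z) := by
  obtain ⟨z', hz'⟩ := hf.exists_mem_convSubdiff_sub_smul hv hγ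
  rwa [hf.proper.eq_of_isProx hγ hz' hz]

/-- Monotonicity gives ⟨v - z, γz⟩ ≥ 0, and Cauchy–Schwarz concludes. The bound does not depend on
γ. -/
lemma IsProper.norm_le_of_mem_convSubdiff_sub_smul (hf : IsProper f) {a v z : E} {γ : ℝ}
    (hγ : 0 < γ) (hv : v ∈ convSubdiff f a) (hz : z ∈ convSubdiff f (a - γ • z)) : ‖z‖ ≤ ‖v‖ := by
  have h := hf.inner_sub_nonneg hv hz
  rw [sub_sub_cancel, inner_smul_right, inner_sub_left, real_inner_self_eq_norm_sq] at h
  have h1 := nonneg_of_mul_nonneg_right h hγ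
  have h2 := real_inner_le_norm v z
  by_contra! hc
  nlinarith [norm_nonneg v]

/-! ### Differentiability of the conjugate -/

/-- If the supporting affine function of slope z were attained at a second point, z would be a
subgradient along the whole segment, which would then lie in dom ∂f; strict convexity at the
midpoint forbids this. -/
lemma IsEssStrictConvex.eq_of_mem_convSubdiff (hf : IsEssStrictConvex f)
    (hc : ConvexOn ℝ (effDom f) fun x => (f x).toReal) {w v z : E} (hz : z ∈ convSubdiff f w)
    (hv : v ∈ effDom f) (h : (f v).toReal ≤ (f w).toReal + ⟪z, v - w⟫) : v = w := by
  have hp := hf.1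
  by_contra hne
  have hseg : ∀ t ∈ segment ℝ w v, z ∈ convSubdiff f t := by
    rintro _ ⟨a, b, ha, hb, hab, rfl⟩
    have hcv := hc.2 hz.1 hv ha hb hab
    refine hp.mem_convSubdiff (hc.1 hz.1 hv ha hb hab) fun x hx => ?_
    have h1 := hp.subgradient_le hz hx
    have h2 : x - (a • w + b • v) = (x - w) - b • (v - w) := by
      have : a = 1 - b := by linarith
      subst this
      module
    rw [h2, inner_sub_right, inner_smul_right]
    simp only [smul_eq_mul] at hcv
    have : a = 1 - b := by linarith
    subst this
    nlinarith
  have hsc := hf.2 (segment ℝ w v) (convex_segment w v) fun t ht => ⟨z, hseg t ht⟩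
  have hlt := hsc.2 (left_mem_segment ℝ w v) (right_mem_segment ℝ w v) (Ne.symm hne)
    (by norm_num : (0 : ℝ) < 1 / 2) (by norm_num : (0 : ℝ) < 1 / 2) (by norm_num)
  have hmid : (1 / 2 : ℝ) • w + (1 / 2 : ℝ) • v ∈ effDom f :=
    hc.1 hz.1 hv (by norm_num) (by norm_num) (by norm_num)
  have h3 := hp.subgradient_le hz hmid
  have h4 : (1 / 2 : ℝ) • w + (1 / 2 : ℝ) • v - w = (1 / 2 : ℝ) • (v - w) := by module
  rw [h4, inner_smul_right] at h3
  simp only [smul_eq_mul] at hlt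
  linarith

/-- The gap between `f` and its supporting affine function is bounded below by some c > 0 on the
sphere of radius r, by compactness and strictness. Convexity along rays from w extends this to
linear growth with slope c/r outside. -/
lemma IsEssStrictConvex.exists_growth [ProperSpace E] (hf : IsEssStrictConvex f)
    (hf' : IsProperConvexLsc f) {w z : E} (hz : z ∈ convSubdiff f w) {r : ℝ} (hr : 0 < r) :
    ∃ c > 0, ∀ v ∈ effDom f, r ≤ ‖v - w‖ →
      (f w).toReal + ⟪z, v - w⟫ + c * ‖v - w‖ ≤ (f v).toReal := by
  have hp := hf.1
  set e : E → EReal := fun v => f v + ((-⟪z, v - w⟫ : ℝ) : EReal) with he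
  have hlsc : LowerSemicontinuous e := by
    intro x
    refine LowerSemicontinuousAt.add' (hf'.lsc x) ?_ ?_
    · exact (continuous_coe_real_ereal.comp (by fun_prop)).continuousAt.lowerSemicontinuousAt
    · exact EReal.continuousAt_add (Or.inr (EReal.coe_ne_bot _)) (Or.inr (EReal.coe_ne_top _))
  have hsphere : ∃ c > 0, ∀ v ∈ effDom f, ‖v - w‖ = r →
      (f w).toReal + ⟪z, v - w⟫ + c ≤ (f v).toReal := by
    by_cases hne : (Metric.sphere w r).Nonempty
    · obtain ⟨m, hm, hmin⟩ := (hlsc.lowerSemicontinuousOn (Metric.sphere w r)).exists_isMinOn hne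
        (isCompact_sphere w r)
      by_cases hmd : m ∈ effDom f
      · have hmw : m ≠ w := by
          rintro rfl
          simp at hm
          exact hr.ne hm
        have hpos : (f w).toReal + ⟪z, m - w⟫ < (f m).toReal := by
          by_contra! hcon
          exact hmw (hf.eq_of_mem_convSubdiff hf'.convex hz hmd hcon)
        refine ⟨(f m).toReal - (f w).toReal - ⟪z, m - w⟫, by linarith, fun v hv hvr => ?_⟩
        have h1 : e m ≤ e v := hmin (by rwa [mem_sphere_iff_norm])
        simp only [he] at h1
        rw [← hp.coe_toReal hv, ← hp.coe_toReal hmd, ← EReal.coe_add, ← EReal.coe_add,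
          EReal.coe_le_coe_iff] at h1
        linarith
      · refine ⟨1, one_pos, fun v hv hvr => ?_⟩
        have h1 : e m ≤ e v := hmin (by rwa [mem_sphere_iff_norm])
        have : f m = ⊤ := not_lt_top_iff.mp hmd
        simp only [he] at h1
        rw [← hp.coe_toReal hv, this, EReal.top_add_coe, ← EReal.coe_add, top_le_iff] at h1
        exact absurd h1 (EReal.coe_ne_top _)
    · refine ⟨1, one_pos, fun v hv hvr => ?_⟩
      exact absurd ⟨v, by rwa [mem_sphere_iff_norm]⟩ hne
  obtain ⟨c, hc, hcs⟩ := hsphere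
  refine ⟨c / r, by positivity, fun v hv hvr => ?_⟩
  set t := r / ‖v - w‖ with ht
  have hn : 0 < ‖v - w‖ := hr.trans_le hvr
  have ht0 : 0 < t := by positivity
  have ht1 : t ≤ 1 := (div_le_one hn).mpr hvr
  have hmem : (1 - t) • w + t • v ∈ effDom f :=
    hf'.convex.1 hz.1 hv (by linarith) ht0.le (by ring)
  have hcv := hf'.convex.2 hz.1 hv (by linarith : 0 ≤ 1 - t) ht0.le (by ring)
  have hdiff : (1 - t) • w + t • v - w = t • (v - w) := by module
  have hnt : t * ‖v - w‖ = r := div_mul_cancel₀ r hn.ne'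
  have h1 := hcs _ hmem (by
    rw [hdiff, norm_smul, Real.norm_of_nonneg ht0.le, hnt])
  rw [hdiff, inner_smul_right] at h1
  simp only [smul_eq_mul] at hcv
  have h2 : c = t * (c / r * ‖v - w‖) := by
    rw [ht]; field_simp
  have h3 : t * ((f w).toReal + ⟪z, v - w⟫ + c / r * ‖v - w‖) ≤ t * (f v).toReal := by linarith
  exact le_of_mul_le_mul_left h3 ht0

/-- In the supremum defining the conjugate, points far from w are beaten by the growth of `f` once
‖z' - z‖ < c, and points within r of w cost at most r‖z' - z‖. Together with Fenchel–Young from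
below this yields differentiability. -/
lemma IsEssStrictConvex.fenchelConj_le_near [ProperSpace E] (hf : IsEssStrictConvex f)
    (hf' : IsProperConvexLsc f) {w z : E} (hz : z ∈ convSubdiff f w) {r : ℝ} (hr : 0 < r) :
    ∀ᶠ z' in 𝓝 z, fenchelConj f z' ≤
      (((fenchelConj f z).toReal + ⟪w, z' - z⟫ + r * ‖z' - z‖ : ℝ) : EReal) := by
  have hp := hf.1
  obtain ⟨c, hc, hgrow⟩ := hf.exists_growth hf' hz hr
  filter_upwards [Metric.ball_mem_nhds z hc] with z' hz'
  rw [mem_ball_iff_norm] at hz'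
  refine hp.fenchelConj_le fun v hv => ?_
  rw [hp.fenchelConj_toReal hz]
  have hid : ⟪z', v⟫ = ⟪z, v - w⟫ + ⟪z, w⟫ + ⟪w, z' - z⟫ + ⟪z' - z, v - w⟫ := by
    rw [inner_sub_right, inner_sub_right, inner_sub_left, inner_sub_right, inner_sub_right,
      real_inner_comm w z, real_inner_comm w z']
    ring
  have hcs := real_inner_le_norm (z' - z) (v - w)
  rcases le_total r ‖v - w‖ with h | h
  · have h1 := hgrow v hv h
    have h2 : ‖z' - z‖ * ‖v - w‖ ≤ c * ‖v - w‖ := by gcongr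
    have h3 : 0 ≤ r * ‖z' - z‖ := by positivity
    linarith
  · have h1 := hp.subgradient_le hz hv
    have h2 : ‖z' - z‖ * ‖v - w‖ ≤ ‖z' - z‖ * r := by gcongr
    linarith

lemma IsEssStrictConvex.hasGradientAt_fenchelConj [ProperSpace E] (hf : IsEssStrictConvex f)
    (hf' : IsProperConvexLsc f) {w z : E} (hz : z ∈ convSubdiff f w) :
    HasGradientAt (fun z => (fenchelConj f z).toReal) w z := by
  have hp := hf.1
  rw [hasGradientAt_iff_isLittleO, Asymptotics.isLittleO_iff]
  intro r hr
  filter_upwards [hf.fenchelConj_le_near hf' hz hr] with z' hz'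
  have hd : z' ∈ effDom (fenchelConj f) := hz'.trans_lt (EReal.coe_lt_top _)
  have h1 := hp.le_fenchelConj_toReal hz.1 hd
  have h2 := hp.fenchelConj_toReal hz
  rw [← hp.fenchelConj_coe_toReal hd, EReal.coe_le_coe_iff] at hz'
  have h3 : ⟪w, z' - z⟫ = ⟪z', w⟫ - ⟪z, w⟫ := by
    rw [inner_sub_right, real_inner_comm w z, real_inner_comm w z']
  rw [Real.norm_eq_abs, abs_of_nonneg (by linarith)]
  linarith

end ConvexAnalysisLemmas

/-! ### The Kurdyka–Łojasiewicz property and finite length. -/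

section KurdykaLojasiewicz

variable {E : Type*} [NormedAddCommGroup E] [InnerProductSpace ℝ E] {F : E → EReal}

lemma frechetSubdiff_subset_limitingSubdiff (F : E → EReal) (a : E) :
    frechetSubdiff F a ⊆ limitingSubdiff F a := fun v hv =>
  ⟨hv.1, hv.2.1, fun _ => a, fun _ => v, tendsto_const_nhds, tendsto_const_nhds,
    tendsto_const_nhds, fun _ => hv⟩

/-- A differentiable function plus a linear term that minorizes `F` locally and touches it at a
suffices; c will be a normal vector to the feasible set. -/
lemma add_mem_frechetSubdiff {Q : E → ℝ} {Q' : E →L[ℝ] ℝ} {a v c : E}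
    (hQ : HasFDerivAt Q Q' a) (hv : ∀ d, Q' d = ⟪v, d⟫) (hFa : F a = Q a)
    (hle : ∀ᶠ x in 𝓝 a, ((Q x + ⟪c, x - a⟫ : ℝ) : EReal) ≤ F x) :
    v + c ∈ frechetSubdiff F a := by
  refine ⟨by rw [hFa]; exact EReal.coe_ne_bot _, by
    change F a < ⊤
    rw [hFa]; exact EReal.coe_lt_top _, fun η hη => ?_⟩
  have ho := hQ.isLittleO
  rw [Asymptotics.isLittleO_iff] at ho
  filter_upwards [ho hη, hle] with x hx hx'
  refine le_trans ?_ hx'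
  rw [hFa, ← EReal.coe_add, EReal.coe_le_coe_iff]
  rw [hv] at hx
  have := neg_le_of_abs_le hx
  rw [inner_add_left]
  linarith

/-- The desingularizing function of a KL point, together with a function playing the role of its
derivative, on a right neighbourhood of zero with real endpoint. -/
lemma HasKLAt.exists_desingularizing {a : E} (h : HasKLAt F a) {r₀ : ℝ} (ha : F a = r₀) :
    ∃ U ∈ 𝓝 a, ∃ η > (0 : ℝ), ∃ φ ψ : ℝ → ℝ, (∀ t, 0 ≤ t → t < η → 0 ≤ φ t) ∧
      (∀ s t, 0 ≤ s → s ≤ t → 0 < t → t < η → 0 ≤ ψ t ∧ ψ t * (t - s) ≤ φ t - φ s) ∧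
      ∀ x ∈ U, ∀ r : ℝ, F x = r → r₀ < r → r < r₀ + η → ∀ v ∈ limitingSubdiff F x,
        1 ≤ ψ (r - r₀) * ‖v‖ := by
  obtain ⟨-, μ, U, φ, hμ, hU, haU, hφ0, -, hconc, hdiff, -, -, hpos, hKL⟩ := h
  -- Since μ may be infinite, a real η below it is chosen.
  obtain ⟨η, hη0, hημ⟩ := EReal.lt_iff_exists_real_btwn.mp hμ
  have hη : 0 < η := by exact_mod_cast hη0
  have hlt : ∀ t, t < η → (t : EReal) < μ := fun t ht =>
    lt_trans (EReal.coe_lt_coe_iff.mpr ht) hημ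
  refine ⟨U, hU.mem_nhds haU, η, hη, φ, deriv φ, fun t h0 ht => hφ0 t h0 (hlt t ht), ?_, ?_⟩
  · intro s t hs hst ht htη
    refine ⟨(hpos t ht (hlt t htη)).le, ?_⟩
    rcases hst.eq_or_lt with rfl | hst
    · simp
    have hd : DifferentiableAt ℝ φ t := by
      refine (hdiff t ⟨ht, hlt t htη⟩).differentiableAt ?_
      filter_upwards [Ioo_mem_nhds ht htη] with x hx
      exact ⟨hx.1, hlt x hx.2⟩
    -- Concavity: the derivative at the right endpoint is at most the slope of the chord.
    have hsl := hconc.deriv_le_slope ⟨hs, hlt s (hst.trans htη)⟩ ⟨ht.le, hlt t htη⟩ hst hd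
    rwa [slope_def_field, le_div_iff₀ (sub_pos.mpr hst)] at hsl
  · intro x hx r hFx hr hrη v hv
    have h1 := hKL x hx (by rw [ha, hFx]; exact_mod_cast hr) (by
      rw [ha, hFx]
      refine lt_of_lt_of_le ?_ (add_le_add_right hημ.le _)
      rw [← EReal.coe_add]
      exact_mod_cast hrη)
    rw [hFx, ha, EReal.toReal_coe, EReal.toReal_coe] at h1
    have h2 : Metric.infEDist 0 (limitingSubdiff F x) ≤ ENNReal.ofReal ‖v‖ := by
      refine (Metric.infEDist_le_edist_of_mem hv).trans ?_
      rw [edist_dist, dist_zero_left]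
    have h3 : (1 : ℝ≥0∞) ≤ ENNReal.ofReal (deriv φ (r - r₀) * ‖v‖) := by
      rw [ENNReal.ofReal_mul (hpos _ (by linarith) (hlt _ (by linarith))).le]
      exact h1.trans (by gcongr)
    exact ENNReal.one_le_ofReal.mp h3

lemma summable_of_two_mul_le {a T : ℕ → ℝ} (ha : ∀ k, 0 ≤ a k) (hT : ∀ k, 0 ≤ T k)
    (h : ∀ k, 2 * a (k + 1) ≤ a k + (T k - T (k + 1))) : Summable a := by
  rw [← summable_nat_add_iff 1]
  have key : ∀ N, ∑ k ∈ Finset.range N, a (k + 1) + a N ≤ a 0 + T 0 - T N := by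
    intro N
    induction N with
    | zero => simp
    | succ N ih =>
      rw [Finset.sum_range_succ]
      linarith [h N]
  refine summable_of_sum_range_le (c := a 0 + T 0) (fun k => ha (k + 1)) fun N => ?_
  linarith [key N, ha N, hT N]

/-- Finite length of a bounded sequence along which `F` decreases sufficiently, with a relative
error bound for its limiting subdifferential, if `F` has the KL property at all cluster points. -/
lemma summable_of_hasKLAt {K : Set E} (hK : IsCompact K) {w : ℕ → E} (hw : ∀ k, w k ∈ K)
    {r a : ℕ → ℝ} {r₀ c C : ℝ} (hF : ∀ k, F (w k) = r k) (hr : Tendsto r atTop (𝓝 r₀))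
    (hc : 0 < c) (hC : 0 ≤ C) (ha : ∀ k, 0 ≤ a k) (hdec : ∀ k, r (k + 1) + c * a k ^ 2 ≤ r k)
    (hcl : ∀ p, MapClusterPt p atTop w → F p = r₀ ∧ HasKLAt F p)
    (hv : ∀ k, ∃ v ∈ limitingSubdiff F (w (k + 1)), ‖v‖ ≤ C * (a k + (r k - r (k + 1)))) :
    Summable a := by
  have hanti : Antitone r := antitone_nat_of_succ_le fun k => by
    have : 0 ≤ c * a k ^ 2 := by positivity
    linarith [hdec k]
  have hr₀ : ∀ k, r₀ ≤ r k := fun k => hanti.le_of_tendsto hr k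
  have hloc : ∀ p : E, ∃ V ∈ 𝓝 p, ∃ η > (0 : ℝ), ∃ φ ψ : ℝ → ℝ, (∀ t, 0 ≤ t → t < η → 0 ≤ φ t) ∧
      (∀ s t, 0 ≤ s → s ≤ t → 0 < t → t < η → 0 ≤ ψ t ∧ ψ t * (t - s) ≤ φ t - φ s) ∧
      ∀ᶠ k in atTop, w k ∈ V → r₀ < r k → ∀ v ∈ limitingSubdiff F (w k),
        1 ≤ ψ (r k - r₀) * ‖v‖ := by
    intro p
    by_cases hp : MapClusterPt p atTop w
    · obtain ⟨hFp, hKL⟩ := hcl p hp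
      obtain ⟨U, hU, η, hη, φ, ψ, h1, h2, h3⟩ := hKL.exists_desingularizing hFp
      refine ⟨U, hU, η, hη, φ, ψ, h1, h2, ?_⟩
      filter_upwards [hr.eventually_lt_const (lt_add_of_pos_right r₀ hη)] with k hk hkU hk' v hv
      exact h3 _ hkU _ (hF k) hk' hk v hv
    · rw [mapClusterPt_iff_frequently] at hp
      push Not at hp
      obtain ⟨V, hV, hV'⟩ := hp
      -- Near a point that is not a cluster point the sequence is eventually absent, so trivial data
      -- suffice.
      refine ⟨V, hV, 1, one_pos, 0, 0, by simp, by simp, ?_⟩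
      filter_upwards [hV'] with k hk hkV
      exact absurd hkV hk
  choose V hV η hη φ ψ hφ hψ hev using hloc
  obtain ⟨t, -, ht⟩ := hK.elim_nhds_subcover V fun p _ => hV p
  have hev1 : ∀ᶠ k in atTop, ∀ p ∈ t, r k < r₀ + η p ∧
      (w k ∈ V p → r₀ < r k → ∀ v ∈ limitingSubdiff F (w k), 1 ≤ ψ p (r k - r₀) * ‖v‖) := by
    rw [Finset.eventually_all]
    exact fun p _ => (hr.eventually_lt_const (lt_add_of_pos_right r₀ (hη p))).and (hev p)
  obtain ⟨k₀, hk₀⟩ := eventually_atTop.mp hev1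
  -- Summing over the finite cover gives one potential that serves whichever neighbourhood contains
  -- the current iterate: while r k > r₀ each summand decreases, so the drop of one is at most the
  -- drop of Φ.
  set Φ : ℕ → ℝ := fun k => ∑ p ∈ t, φ p (r k - r₀) with hΦ
  have hΦ0 : ∀ k, k₀ ≤ k → 0 ≤ Φ k := fun k hk => Finset.sum_nonneg fun p hp =>
    hφ p _ (by linarith [hr₀ k]) (by linarith [(hk₀ k hk p hp).1])
  have hterm : ∀ k, k₀ ≤ k → r₀ < r k → ∀ p ∈ t, 0 ≤ ψ p (r k - r₀) ∧
      ψ p (r k - r₀) * (r k - r (k + 1)) ≤ φ p (r k - r₀) - φ p (r (k + 1) - r₀) := by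
    intro k hk hlt p hp
    have := hψ p (r (k + 1) - r₀) (r k - r₀) (by linarith [hr₀ (k + 1)])
      (by linarith [hanti (Nat.le_succ k)]) (by linarith) (by linarith [(hk₀ k hk p hp).1])
    rwa [sub_sub_sub_cancel_right] at this
  -- The potential also contains r because the subgradient bound involves r k - r (k + 1) besides a
  -- k.
  have hstep : ∀ k, k₀ ≤ k → 2 * a (k + 1) ≤ a k + ((r k + C / c * Φ (k + 1))
      - (r (k + 1) + C / c * Φ (k + 2))) := by
    intro k hk
    have hk1 : k₀ ≤ k + 1 := by omega
    have hrr : r (k + 1) ≤ r k := hanti (Nat.le_succ k)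
    have hrr' : r (k + 2) ≤ r (k + 1) := hanti (Nat.le_succ (k + 1))
    rcases (hr₀ (k + 1)).eq_or_lt with heq | hlt
    · have h2 : r (k + 2) = r₀ := le_antisymm (heq ▸ hrr') (hr₀ _)
      have h3 : a (k + 1) = 0 := by
        have := hdec (k + 1)
        rw [show k + 1 + 1 = k + 2 from rfl, h2, ← heq] at this
        have h4 : a (k + 1) ^ 2 ≤ 0 := by
          by_contra! hcon
          have := mul_pos hc hcon
          linarith
        exact pow_eq_zero_iff two_ne_zero |>.mp (le_antisymm h4 (sq_nonneg _))
      have h4 : Φ (k + 2) = Φ (k + 1) := by simp only [hΦ, h2, ← heq]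
      rw [h3, h4]
      linarith [ha k]
    · obtain ⟨p, hp, hwp⟩ := mem_iUnion₂.mp (ht (hw (k + 1)))
      obtain ⟨v, hv, hvn⟩ := hv k
      have h1 := (hk₀ (k + 1) hk1 p hp).2 hwp hlt v hv
      have h2 : ψ p (r (k + 1) - r₀) * (r (k + 1) - r (k + 2)) ≤ Φ (k + 1) - Φ (k + 2) := by
        rw [hΦ]
        simp only
        rw [← Finset.sum_sub_distrib]
        refine (hterm (k + 1) hk1 hlt p hp).2.trans ?_
        refine Finset.single_le_sum
          (f := fun p => φ p (r (k + 1) - r₀) - φ p (r (k + 2) - r₀)) (fun i hi => ?_) hp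
        obtain ⟨h3, h4⟩ := hterm (k + 1) hk1 hlt i hi
        exact (mul_nonneg h3 (by linarith)).trans h4
      have hψ0 := (hterm (k + 1) hk1 hlt p hp).1
      have hd := hdec (k + 1)
      rw [show k + 1 + 1 = k + 2 from rfl] at hd
      set b := a k + (r k - r (k + 1)) with hb
      have hb0 : 0 ≤ b := by linarith [ha k]
      set D := Φ (k + 1) - Φ (k + 2) with hD
      have hs : r (k + 1) - r (k + 2) ≤ ψ p (r (k + 1) - r₀) * (r (k + 1) - r (k + 2)) * ‖v‖ := by
        nlinarith
      have hD0 : 0 ≤ D := le_trans (mul_nonneg hψ0 (by linarith)) h2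
      have h5 : c * a (k + 1) ^ 2 ≤ D * (C * b) := by
        calc c * a (k + 1) ^ 2 ≤ ψ p (r (k + 1) - r₀) * (r (k + 1) - r (k + 2)) * ‖v‖ := by linarith
          _ ≤ D * (C * b) := by gcongr
      have h6 : a (k + 1) ^ 2 ≤ (C / c * D) * b := by
        rw [div_mul_eq_mul_div, div_mul_eq_mul_div, le_div_iff₀ hc]
        linarith
      have h7 : 0 ≤ C / c * D := by positivity
      -- Arithmetic–geometric mean inequality applied to the two factors in the bound for a (k + 1)
      -- ^ 2.
      have h8 : 2 * a (k + 1) ≤ b + C / c * D := by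
        refine abs_le_of_sq_le_sq' ?_ (by positivity) |>.2
        nlinarith [sq_nonneg (b - C / c * D)]
      rw [hb, hD] at h8
      linarith
  rw [← summable_nat_add_iff k₀]
  refine summable_of_two_mul_le (T := fun k => r (k + k₀) - r₀ + C / c * Φ (k + k₀ + 1))
    (fun k => ha _) (fun k => ?_) fun k => ?_
  · have h1 := hr₀ (k + k₀)
    have h2 := hΦ0 (k + k₀ + 1) (by omega)
    have : 0 ≤ C / c * Φ (k + k₀ + 1) := by positivity
    linarith
  · have := hstep (k + k₀) (by omega)
    rw [show k + 1 + k₀ = k + k₀ + 1 by omega, show k + k₀ + 1 + 1 = k + k₀ + 2 by omega]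
    linarith

lemma mem_domLimitingSubdiff_of_tendsto {w v : ℕ → E} {p : E} {r₀ : ℝ} (hp : F p = r₀)
    (hw : Tendsto w atTop (𝓝 p)) (hF : Tendsto (fun k => F (w k)) atTop (𝓝 r₀))
    (hv : Tendsto v atTop (𝓝 0)) (hmem : ∀ k, v k ∈ frechetSubdiff F (w k)) :
    p ∈ domLimitingSubdiff F :=
  ⟨0, by rw [hp]; exact EReal.coe_ne_bot _, mem_effDom_of_eq_coe hp, w, v, hw, hp ▸ hF, hv, hmem⟩

lemma tendsto_zero_of_add_mul_sq_le {r a : ℕ → ℝ} {r₀ c : ℝ} (hr : Tendsto r atTop (𝓝 r₀))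
    (hc : 0 < c) (ha : ∀ k, 0 ≤ a k) (hdec : ∀ k, r (k + 1) + c * a k ^ 2 ≤ r k) :
    Tendsto a atTop (𝓝 0) := by
  have h1 : Tendsto (fun k => √((r k - r (k + 1)) / c)) atTop (𝓝 0) := by
    have h2 := ((hr.sub (hr.comp (tendsto_add_atTop_nat 1))).div_const c).sqrt
    rwa [sub_self, zero_div, Real.sqrt_zero] at h2
  refine squeeze_zero ha (fun k => ?_) h1
  refine Real.le_sqrt_of_sq_le ?_
  rw [le_div_iff₀ hc]
  linarith [hdec k]

/-- A variant of `summable_of_hasKLAt` with Fréchet subgradients, for which the cluster points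
automatically lie in the domain of the limiting subdifferential. -/
lemma summable_of_hasKLAt_of_frechetSubdiff {K : Set E} (hK : IsCompact K) {w : ℕ → E}
    (hw : ∀ k, w k ∈ K) {r a : ℕ → ℝ} {r₀ c C : ℝ} (hF : ∀ k, F (w k) = r k)
    (hr : Tendsto r atTop (𝓝 r₀)) (hc : 0 < c) (hC : 0 ≤ C) (ha : ∀ k, 0 ≤ a k)
    (hdec : ∀ k, r (k + 1) + c * a k ^ 2 ≤ r k)
    (hcl : ∀ p (ψ : ℕ → ℕ), Tendsto ψ atTop atTop → Tendsto (fun k => w (ψ k)) atTop (𝓝 p) →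
      F p = r₀ ∧ (p ∈ domLimitingSubdiff F → HasKLAt F p))
    (hv : ∀ k, ∃ v ∈ frechetSubdiff F (w (k + 1)), ‖v‖ ≤ C * (a k + (r k - r (k + 1)))) :
    Summable a := by
  refine summable_of_hasKLAt hK hw hF hr hc hC ha hdec (fun p hp => ?_) fun k => ?_
  · obtain ⟨ψ, hψ, hwψ⟩ := hp.tendsto_subseq
    obtain ⟨hFp, hKL⟩ := hcl p ψ hψ.tendsto_atTop hwψ
    refine ⟨hFp, hKL ?_⟩
    choose v hv hvn using hv
    have hv0 : Tendsto v atTop (𝓝 0) := by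
      refine squeeze_zero_norm hvn ?_
      have := ((tendsto_zero_of_add_mul_sq_le hr hc ha hdec).add
        (hr.sub (hr.comp (tendsto_add_atTop_nat 1)))).const_mul C
      simpa using this
    -- Subgradients are available only at indices of the form k + 1; the shift ensures ψ (k + 1) ≥
    -- 1, so that the natural subtraction below is harmless.
    have hψ1 : Tendsto (fun k => ψ (k + 1)) atTop atTop :=
      hψ.tendsto_atTop.comp (tendsto_add_atTop_nat 1)
    have hψ2 : ∀ k, ψ (k + 1) - 1 + 1 = ψ (k + 1) := fun k =>
      Nat.sub_add_cancel ((Nat.le_add_left 1 k).trans (hψ.le_apply))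
    refine mem_domLimitingSubdiff_of_tendsto hFp (hwψ.comp (tendsto_add_atTop_nat 1))
      (v := fun k => v (ψ (k + 1) - 1)) ?_ (hv0.comp ((tendsto_sub_atTop_nat 1).comp hψ1))
      fun k => ?_
    · simp only [Function.comp_apply, hF]
      exact (continuous_coe_real_ereal.tendsto r₀).comp (hr.comp hψ1)
    · have := hv (ψ (k + 1) - 1)
      rwa [hψ2] at this
  · obtain ⟨v, hv, hvn⟩ := hv k
    exact ⟨v, frechetSubdiff_subset_limitingSubdiff F _ hv, hvn⟩

end KurdykaLojasiewicz

/-! ### The descent lemma and the projection inequality. -/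

section SmoothFunctions

variable {E : Type*} [NormedAddCommGroup E] [InnerProductSpace ℝ E] [CompleteSpace E]

/-- Along the segment, φ minus its linearization minus the quadratic bound has nonpositive
derivative. -/
lemma le_add_inner_gradient_add_sq {φ : E → ℝ} {C : Set E} {L : ℝ≥0} (hC : Convex ℝ C)
    (hd : ∀ x ∈ C, DifferentiableAt ℝ φ x) (hL : LipschitzOnWith L (gradient φ) C) {x y : E}
    (hx : x ∈ C) (hy : y ∈ C) :
    φ y ≤ φ x + ⟪gradient φ x, y - x⟫ + L / 2 * ‖y - x‖ ^ 2 := by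
  set d := y - x with hdef
  have hmem : ∀ t ∈ Icc (0 : ℝ) 1, x + t • d ∈ C := fun t ht => by
    have := hC hx hy (sub_nonneg.mpr ht.2) ht.1 (by ring)
    rwa [show x + t • d = (1 - t) • x + t • y by rw [hdef]; module]
  set ξ : ℝ → ℝ := fun t => φ (x + t • d) - t * ⟪gradient φ x, d⟫ - L / 2 * t ^ 2 * ‖d‖ ^ 2 with hξ
  have hder : ∀ t ∈ Icc (0 : ℝ) 1, HasDerivAt ξ
      (⟪gradient φ (x + t • d), d⟫ - ⟪gradient φ x, d⟫ - L * t * ‖d‖ ^ 2) t := by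
    intro t ht
    have h1 : HasDerivAt (fun t : ℝ => x + t • d) d t := by
      simpa using ((hasDerivAt_id t).smul_const d).const_add x
    have h2 := ((hd _ (hmem t ht)).hasGradientAt.hasFDerivAt).comp_hasDerivAt t h1
    have h3 := (h2.sub ((hasDerivAt_id t).mul_const ⟪gradient φ x, d⟫)).sub
      (((hasDerivAt_pow 2 t).const_mul ((L : ℝ) / 2)).mul_const (‖d‖ ^ 2))
    refine h3.congr_deriv ?_
    simp only [InnerProductSpace.toDual_apply_apply, one_mul, Nat.cast_ofNat]
    ring
  have hanti : AntitoneOn ξ (Icc 0 1) := by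
    refine antitoneOn_of_deriv_nonpos (convex_Icc 0 1)
      (fun t ht => (hder t ht).continuousAt.continuousWithinAt)
      (fun t ht => (hder t (interior_subset ht)).differentiableAt.differentiableWithinAt)
      fun t ht => ?_
    have ht' := interior_subset ht
    rw [(hder t ht').deriv, ← inner_sub_left]
    have h1 := real_inner_le_norm (gradient φ (x + t • d) - gradient φ x) d
    have h2 := hL.norm_sub_le (hmem t ht') hx
    rw [add_sub_cancel_left, norm_smul, Real.norm_of_nonneg ht'.1] at h2
    have h3 : ‖gradient φ (x + t • d) - gradient φ x‖ * ‖d‖ ≤ L * (t * ‖d‖) * ‖d‖ := by gcongr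
    nlinarith
  have h := hanti (left_mem_Icc.mpr zero_le_one) (right_mem_Icc.mpr zero_le_one) zero_le_one
  simp only [hξ, one_smul, zero_smul, add_zero, one_mul, zero_mul, one_pow, mul_one, ne_eq,
    OfNat.ofNat_ne_zero, not_false_eq_true, zero_pow, mul_zero, sub_zero] at h
  have hxy : x + d = y := by rw [hdef]; abel
  rw [hxy] at h
  linarith

omit [CompleteSpace E] in
lemma IsProj.inner_le_zero {C : Set E} (hC : Convex ℝ C) {x y : E} (h : IsProj C x y) {s : E}
    (hs : s ∈ C) : ⟪x - y, s - y⟫ ≤ 0 := by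
  have : Nonempty C := ⟨⟨y, h.1⟩⟩
  refine (norm_eq_iInf_iff_real_inner_le_zero hC h.1).mp ?_ s hs
  refine le_antisymm (le_ciInf fun w => h.2 w w.2) ?_
  exact ciInf_le (f := fun w : C => ‖x - w‖) ⟨0, by rintro _ ⟨w, rfl⟩; exact norm_nonneg _⟩ ⟨y, h.1⟩

end SmoothFunctions

/-! ### Consequences of the basic assumptions and the one-step descent inequality. -/

namespace FracProgram

variable {n p s : ℕ} {P : FracProgram n p s} {L : ℝ≥0}

lemma inner_Aadj_left (v : Eucl s) (w : Eucl n) : ⟪P.Aadj v, w⟫ = ⟪v, P.A w⟫ :=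
  ContinuousLinearMap.adjoint_inner_left P.A w v

lemma inner_Kadj_left (v : Eucl p) (w : Eucl n) : ⟪P.Kadj v, w⟫ = ⟪v, P.K w⟫ :=
  ContinuousLinearMap.adjoint_inner_left P.K w v

lemma norm_Aadj_le (v : Eucl s) : ‖P.Aadj v‖ ≤ ‖P.A‖ * ‖v‖ := by
  have := P.Aadj.le_opNorm v
  rwa [Aadj, LinearIsometryEquiv.norm_map] at this

lemma norm_Kadj_le (v : Eucl p) : ‖P.Kadj v‖ ≤ ‖P.K‖ * ‖v‖ := by
  have := P.Kadj.le_opNorm v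
  rwa [Kadj, LinearIsometryEquiv.norm_map] at this

namespace BasicAssumptions

variable (hP : P.BasicAssumptions L)
include hP

lemma differentiableAt_h {x : Eucl n} (hx : x ∈ P.S) : DifferentiableAt ℝ P.h x := by
  obtain ⟨O, hO, hSO, hd, -⟩ := hP.h_smooth
  exact (hd x (hSO hx)).differentiableAt (hO.mem_nhds (hSO hx))

lemma lipschitzOn_gradient_h : LipschitzOnWith L (gradient P.h) P.S := by
  obtain ⟨O, hO, hSO, -, hL⟩ := hP.h_smooth
  exact hL.mono hSO

lemma continuousOn_f : ContinuousOn (fun x => (P.f (P.K x)).toReal) P.S :=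
  hP.f_pcl.convex.continuousOn_interior.comp P.K.continuous.continuousOn
    fun x hx => hP.KS_subset ⟨x, hx, rfl⟩

lemma mem_effDom_f {x : Eucl n} (hx : x ∈ P.S) : P.K x ∈ effDom P.f :=
  interior_subset (hP.KS_subset ⟨x, hx, rfl⟩)

lemma f_toReal_pos {x : Eucl n} (hx : x ∈ P.S) : 0 < (P.f (P.K x)).toReal := by
  have h := hP.f_pos x hx
  rw [← hP.f_pcl.proper.coe_toReal (hP.mem_effDom_f hx)] at h
  exact_mod_cast h

lemma exists_f_bounds : ∃ m > 0, ∃ M, ∀ x ∈ P.S,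
    m ≤ (P.f (P.K x)).toReal ∧ (P.f (P.K x)).toReal ≤ M := by
  obtain ⟨a, ha, hmin⟩ := hP.S_compact.exists_isMinOn hP.S_nonempty hP.continuousOn_f
  obtain ⟨b, -, hmax⟩ := hP.S_compact.exists_isMaxOn hP.S_nonempty hP.continuousOn_f
  exact ⟨_, hP.f_toReal_pos ha, _, fun x hx => ⟨hmin hx, hmax hx⟩⟩

/-- From `K x` one can move a distance ρ in the direction of the subgradient and stay where |f| ≤ B;
the subgradient inequality then reads ρ‖y‖ ≤ 2B. -/
lemma exists_subgradient_f_bound :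
    ∃ R, ∀ x ∈ P.S, ∀ y ∈ convSubdiff P.f (P.K x), ‖y‖ ≤ R := by
  have hKc : IsCompact (P.K '' P.S) := hP.S_compact.image P.K.continuous
  obtain ⟨ρ, hρ, hsub⟩ := hKc.exists_cthickening_subset_open isOpen_interior hP.KS_subset
  obtain ⟨B, hB⟩ := (hKc.cthickening (r := ρ)).exists_bound_of_continuousOn
    (hP.f_pcl.convex.continuousOn_interior.mono hsub)
  refine ⟨2 * B / ρ, fun x hx y hy => ?_⟩
  have hxm : P.K x ∈ Metric.cthickening ρ (P.K '' P.S) :=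
    Metric.self_subset_cthickening _ ⟨x, hx, rfl⟩
  have hB0 : 0 ≤ B := (norm_nonneg _).trans (hB _ hxm)
  rcases eq_or_ne y 0 with rfl | hy0
  · rw [norm_zero]; positivity
  have hyn : 0 < ‖y‖ := norm_pos_iff.mpr hy0
  have hwm : P.K x + (ρ / ‖y‖) • y ∈ Metric.cthickening ρ (P.K '' P.S) := by
    refine Metric.mem_cthickening_of_dist_le _ (P.K x) _ _ ⟨x, hx, rfl⟩ ?_
    rw [dist_eq_norm, add_sub_cancel_left, norm_smul, Real.norm_of_nonneg (by positivity),
      div_mul_cancel₀ _ hyn.ne']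
  have h1 := hP.f_pcl.proper.subgradient_le hy (interior_subset (hsub hwm))
  rw [add_sub_cancel_left, inner_smul_right, real_inner_self_eq_norm_sq] at h1
  have h2 : ρ / ‖y‖ * ‖y‖ ^ 2 = ρ * ‖y‖ := by field_simp
  have h3 := abs_le.mp (hB _ hxm)
  have h4 := abs_le.mp (hB _ hwm)
  rw [le_div_iff₀ hρ]
  linarith [h3.1, h4.2]

end BasicAssumptions

/-- A tail of the adaptive algorithm along which the smoothing and proximal parameters are
constant and the dual iterates are small. -/
structure SteadyFSPS (P : FracProgram n p s) (β δ γ ε : ℝ) (x : ℕ → Eucl n) (y : ℕ → Eucl p)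
    (z : ℕ → Eucl s) (u : ℕ → Eucl n) (θ : ℕ → ℝ) : Prop where
  x_mem : ∀ k, x k ∈ P.S
  y_mem : ∀ k, y (k + 1) ∈ convSubdiff P.f (P.K (x k))
  x_step : ∀ k, IsProj P.S
    (u k + (θ k / δ) • P.Kadj (y (k + 1)) - (1 / δ) • gradient P.h (x k)
      - (1 / δ) • P.Aadj (z k)) (x (k + 1))
  u_step : ∀ k, u (k + 1) = (1 - β) • u k + β • x (k + 1)
  z_mem : ∀ k, z k ∈ convSubdiff P.g (P.A (x k) - γ • z k)
  z_le : ∀ k, γ * ‖z k‖ ≤ ε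
  z_sq_le : ∀ k, γ / 2 * ‖z k‖ ^ 2 ≤ ε
  θ_eq : ∀ k, θ k = P.Psi (x k) (z k) (u k) δ γ / (P.f (P.K (x k))).toReal
  θ_pos : ∀ k, 0 < θ k

namespace SteadyFSPS

variable {β δ γ ε ν : ℝ} {x : ℕ → Eucl n} {y : ℕ → Eucl p} {z : ℕ → Eucl s} {u : ℕ → Eucl n}
  {θ : ℕ → ℝ} (hP : P.BasicAssumptions L) (h : P.SteadyFSPS β δ γ ε x y z u θ)

/-- The normal vector to the feasible set at `x (k + 1)` given by the projection step. -/
noncomputable def normalVec (P : FracProgram n p s) (δ : ℝ) (x : ℕ → Eucl n) (y : ℕ → Eucl p)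
    (z : ℕ → Eucl s) (u : ℕ → Eucl n) (θ : ℕ → ℝ) (k : ℕ) : Eucl n :=
  δ • (u k - x (k + 1)) + θ k • P.Kadj (y (k + 1)) - gradient P.h (x k) - P.Aadj (z k)

include hP h

lemma inner_normalVec_le (hδ : 0 < δ) (k : ℕ) {v : Eucl n} (hv : v ∈ P.S) :
    ⟪normalVec P δ x y z u θ k, v - x (k + 1)⟫ ≤ 0 := by
  have h1 := (h.x_step k).inner_le_zero hP.S_convex hv
  have h2 : normalVec P δ x y z u θ k = δ • (u k + (θ k / δ) • P.Kadj (y (k + 1))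
      - (1 / δ) • gradient P.h (x k) - (1 / δ) • P.Aadj (z k) - x (k + 1)) := by
    simp only [normalVec, smul_sub, smul_add, smul_smul, mul_div_cancel₀ _ hδ.ne', one_smul]
    abel
  rw [h2, real_inner_smul_left]
  exact mul_nonpos_of_nonneg_of_nonpos hδ.le h1

omit hP in
lemma u_sub_u (k : ℕ) : u k - u (k + 1) = β • (u k - x (k + 1)) := by
  rw [h.u_step k]
  module

omit hP in
lemma x_sub_u (k : ℕ) : x (k + 1) - u (k + 1) = (β - 1) • (u k - x (k + 1)) := by
  rw [h.u_step k]
  module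

lemma psi_eq (k : ℕ) : P.Psi (x k) (z k) (u k) δ γ = θ k * (P.f (P.K (x k))).toReal := by
  rw [h.θ_eq k, div_mul_cancel₀ _ (hP.f_toReal_pos (h.x_mem k)).ne']

lemma psi_pos (k : ℕ) : 0 < P.Psi (x k) (z k) (u k) δ γ := by
  rw [h.psi_eq hP k]
  exact mul_pos (h.θ_pos k) (hP.f_toReal_pos (h.x_mem k))

/-- The linearization of `f ∘ K` at `x k`, evaluated at `x (k + 1)`, is below `f ∘ K`. -/
lemma linearization_le (k : ℕ) :
    (P.f (P.K (x k))).toReal + ⟪y (k + 1), P.K (x (k + 1) - x k)⟫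
      ≤ (P.f (P.K (x (k + 1)))).toReal := by
  rw [map_sub]
  exact hP.f_pcl.proper.subgradient_le (h.y_mem k) (hP.mem_effDom_f (h.x_mem (k + 1)))

/-- Sum of three inequalities: optimality of z k tested at z (k + 1), the projection step tested at
x k, and the descent lemma for `h`. The cross term ⟨Δz, AΔx⟩ is split by Young's inequality, and δ
is such that δ/2 = ν + L/2 + ‖A‖²/γ leaves exactly ν‖Δx‖². -/
lemma psi_succ_le (hγ : 0 < γ) (hν : 0 < ν) (hδ : δ = 2 * ν + L + 2 * ‖P.A‖ ^ 2 / γ)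
    (k : ℕ) :
    P.Psi (x (k + 1)) (z (k + 1)) (u (k + 1)) δ γ + (ν * ‖x k - x (k + 1)‖ ^ 2
      + δ / 2 * ((2 - β) / β) * ‖u k - u (k + 1)‖ ^ 2 + γ / 4 * ‖z k - z (k + 1)‖ ^ 2) ≤
      θ k * ((P.f (P.K (x k))).toReal + ⟪y (k + 1), P.K (x (k + 1) - x k)⟫) := by
  have hδ0 : 0 < δ := by
    have := L.coe_nonneg
    have : 0 ≤ 2 * ‖P.A‖ ^ 2 / γ := by positivity
    linarith
  have hg := hP.g_pcl.proper
  have hψ := h.psi_eq hP k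
  have hN := h.inner_normalVec_le hP hδ0 k (h.x_mem k)
  have hh := le_add_inner_gradient_add_sq hP.S_convex (fun _ hx => hP.differentiableAt_h hx)
    hP.lipschitzOn_gradient_h (h.x_mem k) (h.x_mem (k + 1))
  have hz := hg.sub_sq_le_of_mem_convSubdiff (h.z_mem k)
    (hg.mem_effDom_fenchelConj (h.z_mem (k + 1)))
  have hu1 : ‖u k - u (k + 1)‖ ^ 2 = β ^ 2 * ‖u k - x (k + 1)‖ ^ 2 := by
    rw [h.u_sub_u k, norm_smul, mul_pow, Real.norm_eq_abs, sq_abs]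
  have hu2 : ‖x (k + 1) - u (k + 1)‖ ^ 2 = (β - 1) ^ 2 * ‖u k - x (k + 1)‖ ^ 2 := by
    rw [h.x_sub_u k, norm_smul, mul_pow, Real.norm_eq_abs, sq_abs]
  -- The relaxation step contributes through β(2 - β) + (β - 1)² = 1.
  have hu3 : δ / 2 * ((2 - β) / β) * ‖u k - u (k + 1)‖ ^ 2
      + δ / 2 * ‖x (k + 1) - u (k + 1)‖ ^ 2 = δ / 2 * ‖u k - x (k + 1)‖ ^ 2 := by
    rw [hu1, hu2]
    field_simp
    ring
  have hcross : ⟪z (k + 1) - z k, P.A (x (k + 1) - x k)⟫ ≤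
      γ / 4 * ‖z k - z (k + 1)‖ ^ 2 + ‖P.A‖ ^ 2 / γ * ‖x k - x (k + 1)‖ ^ 2 := by
    have h1 := real_inner_le_norm (z (k + 1) - z k) (P.A (x (k + 1) - x k))
    have h2 := P.A.le_opNorm (x (k + 1) - x k)
    rw [norm_sub_rev (x (k + 1))] at h2
    rw [norm_sub_rev (z (k + 1))] at h1
    have h3 : ‖z k - z (k + 1)‖ * ‖P.A (x (k + 1) - x k)‖ ≤
        ‖z k - z (k + 1)‖ * (‖P.A‖ * ‖x k - x (k + 1)‖) := by gcongr
    have h4 := sq_nonneg (γ / 2 * ‖z k - z (k + 1)‖ - ‖P.A‖ * ‖x k - x (k + 1)‖)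
    have h5 : ‖P.A‖ ^ 2 / γ * ‖x k - x (k + 1)‖ ^ 2 = (‖P.A‖ * ‖x k - x (k + 1)‖) ^ 2 / γ := by
      rw [mul_pow]; ring
    rw [h5, ← sub_le_iff_le_add', le_div_iff₀ hγ]
    nlinarith
  have hux : ‖u k - x k‖ ^ 2 = ‖u k - x (k + 1)‖ ^ 2 - 2 * ⟪u k - x (k + 1), x k - x (k + 1)⟫
      + ‖x k - x (k + 1)‖ ^ 2 := by
    rw [← norm_sub_sq_real]
    congr 2
    abel
  have hN' : ⟪normalVec P δ x y z u θ k, x k - x (k + 1)⟫ =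
      δ * ⟪u k - x (k + 1), x k - x (k + 1)⟫ - θ k * ⟪y (k + 1), P.K (x (k + 1) - x k)⟫
      + ⟪gradient P.h (x k), x (k + 1) - x k⟫ + ⟪z k, P.A (x (k + 1) - x k)⟫ := by
    rw [normalVec, inner_sub_left, inner_sub_left, inner_add_left, real_inner_smul_left,
      real_inner_smul_left, inner_Kadj_left, inner_Aadj_left, ← neg_sub (x (k + 1)) (x k), map_neg,
      map_neg, inner_neg_right, inner_neg_right, inner_neg_right, inner_neg_right]
    ring
  have hAz : ⟪z (k + 1), P.A (x (k + 1))⟫ = ⟪z (k + 1), P.A (x k)⟫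
      + ⟪z k, P.A (x (k + 1) - x k)⟫ + ⟪z (k + 1) - z k, P.A (x (k + 1) - x k)⟫ := by
    rw [inner_sub_left, map_sub, inner_sub_right, inner_sub_right]
    ring
  rw [norm_sub_rev (x (k + 1))] at hh
  rw [norm_sub_rev (z (k + 1))] at hz
  rw [hN'] at hN
  simp only [Psi] at hψ ⊢
  rw [norm_sub_rev (x k), hux] at hψ
  have hδ' : δ / 2 * ‖x k - x (k + 1)‖ ^ 2 = ν * ‖x k - x (k + 1)‖ ^ 2
      + L / 2 * ‖x k - x (k + 1)‖ ^ 2 + ‖P.A‖ ^ 2 / γ * ‖x k - x (k + 1)‖ ^ 2 := by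
    rw [hδ]
    ring
  linarith

end SteadyFSPS

end FracProgram

/-! ### Limits along the iterates, monotonicity of θ, and boundedness. -/

namespace FracProgram

variable {n p s : ℕ} {P : FracProgram n p s} {L : ℝ≥0}

/-- Continuity of g* is not available in general, but on the graph of ∂g it equals ⟨z, w⟩ - g(w),
and the values of `g` converge along the graph. -/
lemma BasicAssumptions.tendsto_psi (hP : P.BasicAssumptions L) {ι : Type*} {l : Filter ι} [l.NeBot]
    {X U : ι → Eucl n} {Z : ι → Eucl s} {x₀ u₀ : Eucl n} {z₀ : Eucl s} {γ : ℝ} (δ : ℝ)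
    (hX : ∀ i, X i ∈ P.S) (hZ : ∀ i, Z i ∈ convSubdiff P.g (P.A (X i) - γ • Z i))
    (hX₀ : Tendsto X l (𝓝 x₀)) (hZ₀ : Tendsto Z l (𝓝 z₀)) (hU₀ : Tendsto U l (𝓝 u₀)) :
    x₀ ∈ P.S ∧ z₀ ∈ convSubdiff P.g (P.A x₀ - γ • z₀) ∧
      Tendsto (fun i => P.Psi (X i) (Z i) (U i) δ γ) l (𝓝 (P.Psi x₀ z₀ u₀ δ γ)) := by
  have hx₀ : x₀ ∈ P.S := hP.S_compact.isClosed.mem_of_tendsto hX₀ (Eventually.of_forall hX)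
  have hA : Tendsto (fun i => P.A (X i)) l (𝓝 (P.A x₀)) := (P.A.continuous.tendsto x₀).comp hX₀
  have hW : Tendsto (fun i => P.A (X i) - γ • Z i) l (𝓝 (P.A x₀ - γ • z₀)) :=
    hA.sub (hZ₀.const_smul γ)
  obtain ⟨hz₀, hg⟩ := hP.g_pcl.mem_convSubdiff_of_tendsto hZ hW hZ₀
  have hh : Tendsto (fun i => P.h (X i)) l (𝓝 (P.h x₀)) :=
    (hP.differentiableAt_h hx₀).continuousAt.tendsto.comp hX₀
  refine ⟨hx₀, hz₀, ?_⟩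
  have hconj : Tendsto (fun i => (fenchelConj P.g (Z i)).toReal) l
      (𝓝 (fenchelConj P.g z₀).toReal) := by
    rw [hP.g_pcl.proper.fenchelConj_toReal hz₀]
    simp only [fun i => hP.g_pcl.proper.fenchelConj_toReal (hZ i)]
    exact (hZ₀.inner hW).sub hg
  exact ((((hZ₀.inner hA).sub hconj).add hh).add (((hX₀.sub hU₀).norm.pow 2).const_mul _)).sub
    ((hZ₀.norm.pow 2).const_mul _)

lemma BasicAssumptions.tendsto_f (hP : P.BasicAssumptions L) {ι : Type*} {l : Filter ι}
    {X : ι → Eucl n} {x₀ : Eucl n} (hX : ∀ i, X i ∈ P.S) (hx₀ : x₀ ∈ P.S)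
    (hX₀ : Tendsto X l (𝓝 x₀)) :
    Tendsto (fun i => (P.f (P.K (X i))).toReal) l (𝓝 (P.f (P.K x₀)).toReal) :=
  (hP.continuousOn_f x₀ hx₀).tendsto.comp
    (tendsto_nhdsWithin_iff.mpr ⟨hX₀, Eventually.of_forall hX⟩)

/-- The length of the `k`-th step of the sequence `(x, u, z)`. -/
noncomputable def stepLength (x u : ℕ → Eucl n) (z : ℕ → Eucl s) (k : ℕ) : ℝ :=
  ‖x k - x (k + 1)‖ + ‖u k - u (k + 1)‖ + ‖z k - z (k + 1)‖

lemma stepLength_nonneg (x u : ℕ → Eucl n) (z : ℕ → Eucl s) (k : ℕ) : 0 ≤ stepLength x u z k := by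
  unfold stepLength
  positivity

lemma norm_x_sub_le_stepLength (x u : ℕ → Eucl n) (z : ℕ → Eucl s) (k : ℕ) :
    ‖x k - x (k + 1)‖ ≤ stepLength x u z k := by
  unfold stepLength
  linarith [norm_nonneg (u k - u (k + 1)), norm_nonneg (z k - z (k + 1))]

lemma norm_u_sub_le_stepLength (x u : ℕ → Eucl n) (z : ℕ → Eucl s) (k : ℕ) :
    ‖u k - u (k + 1)‖ ≤ stepLength x u z k := by
  unfold stepLength
  linarith [norm_nonneg (x k - x (k + 1)), norm_nonneg (z k - z (k + 1))]

lemma norm_z_sub_le_stepLength (x u : ℕ → Eucl n) (z : ℕ → Eucl s) (k : ℕ) :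
    ‖z k - z (k + 1)‖ ≤ stepLength x u z k := by
  unfold stepLength
  linarith [norm_nonneg (x k - x (k + 1)), norm_nonneg (u k - u (k + 1))]

namespace SteadyFSPS

variable {β δ γ ε ν : ℝ} {x : ℕ → Eucl n} {y : ℕ → Eucl p} {z : ℕ → Eucl s} {u : ℕ → Eucl n}
  {θ : ℕ → ℝ} (hP : P.BasicAssumptions L) (h : P.SteadyFSPS β δ γ ε x y z u θ)

include hP h

lemma exists_descent (hγ : 0 < γ) (hβ0 : 0 < β) (hβ2 : β < 2) (hν : 0 < ν)
    (hδ : δ = 2 * ν + L + 2 * ‖P.A‖ ^ 2 / γ) :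
    ∃ c > 0, ∀ k, P.Psi (x (k + 1)) (z (k + 1)) (u (k + 1)) δ γ + c * stepLength x u z k ^ 2 ≤
      θ k * ((P.f (P.K (x k))).toReal + ⟪y (k + 1), P.K (x (k + 1) - x k)⟫) := by
  have hδ0 : 0 < δ := by
    have := L.coe_nonneg
    have : 0 ≤ 2 * ‖P.A‖ ^ 2 / γ := by positivity
    linarith
  set c₁ := δ / 2 * ((2 - β) / β) with hc₁
  have hc₁0 : 0 < c₁ := by
    have : 0 < 2 - β := by linarith
    positivity
  set c := min ν (min c₁ (γ / 4)) with hc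
  have hc0 : 0 < c := lt_min hν (lt_min hc₁0 (by positivity))
  -- The factor 3 comes from (a + b + c)² ≤ 3(a² + b² + c²).
  refine ⟨c / 3, by positivity, fun k => ?_⟩
  have h1 := h.psi_succ_le hP hγ hν hδ k
  rw [← hc₁] at h1
  have h2 : c ≤ ν := min_le_left _ _
  have h3 : c ≤ c₁ := (min_le_right _ _).trans (min_le_left _ _)
  have h4 : c ≤ γ / 4 := (min_le_right _ _).trans (min_le_right _ _)
  have h5 : stepLength x u z k ^ 2 ≤ 3 * (‖x k - x (k + 1)‖ ^ 2 + ‖u k - u (k + 1)‖ ^ 2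
      + ‖z k - z (k + 1)‖ ^ 2) := by
    unfold stepLength
    nlinarith [sq_nonneg (‖x k - x (k + 1)‖ - ‖u k - u (k + 1)‖),
      sq_nonneg (‖x k - x (k + 1)‖ - ‖z k - z (k + 1)‖),
      sq_nonneg (‖u k - u (k + 1)‖ - ‖z k - z (k + 1)‖)]
  have h6 : c / 3 * stepLength x u z k ^ 2 ≤ c / 3 * (3 * (‖x k - x (k + 1)‖ ^ 2
      + ‖u k - u (k + 1)‖ ^ 2 + ‖z k - z (k + 1)‖ ^ 2)) := by gcongr
  have h7 : c * ‖x k - x (k + 1)‖ ^ 2 ≤ ν * ‖x k - x (k + 1)‖ ^ 2 := by gcongr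
  have h8 : c * ‖u k - u (k + 1)‖ ^ 2 ≤ c₁ * ‖u k - u (k + 1)‖ ^ 2 := by gcongr
  have h9 : c * ‖z k - z (k + 1)‖ ^ 2 ≤ γ / 4 * ‖z k - z (k + 1)‖ ^ 2 := by gcongr
  linarith

/-- As θ k > 0 and the linearization is at most f(Kx_{k+1}) ≤ M, the descent inequality may be
divided by f(Kx_{k+1}). -/
lemma exists_θ_descent (hγ : 0 < γ) (hβ0 : 0 < β) (hβ2 : β < 2) (hν : 0 < ν)
    (hδ : δ = 2 * ν + L + 2 * ‖P.A‖ ^ 2 / γ) :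
    ∃ c > 0, ∀ k, θ (k + 1) + c * stepLength x u z k ^ 2 ≤ θ k := by
  obtain ⟨c, hc, hdesc⟩ := h.exists_descent hP hγ hβ0 hβ2 hν hδ
  obtain ⟨m, hm, M, hM⟩ := hP.exists_f_bounds
  have hM0 : 0 < M := hm.trans_le ((hM _ (h.x_mem 0)).1.trans (hM _ (h.x_mem 0)).2)
  refine ⟨c / M, by positivity, fun k => ?_⟩
  have h1 := hdesc k
  rw [h.psi_eq hP] at h1
  have hf := hP.f_toReal_pos (h.x_mem (k + 1))
  have hfM := (hM _ (h.x_mem (k + 1))).2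
  have h2 := mul_le_mul_of_nonneg_left (h.linearization_le hP k) (h.θ_pos k).le
  have h3 : c / M * stepLength x u z k ^ 2 * (P.f (P.K (x (k + 1)))).toReal ≤
      c * stepLength x u z k ^ 2 := by
    calc c / M * stepLength x u z k ^ 2 * (P.f (P.K (x (k + 1)))).toReal
        ≤ c / M * stepLength x u z k ^ 2 * M := by gcongr
      _ = c * stepLength x u z k ^ 2 := by field_simp
  refine le_of_mul_le_mul_right ?_ hf
  linarith

lemma antitone_θ (hγ : 0 < γ) (hβ0 : 0 < β) (hβ2 : β < 2) (hν : 0 < ν)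
    (hδ : δ = 2 * ν + L + 2 * ‖P.A‖ ^ 2 / γ) : Antitone θ := by
  obtain ⟨c, hc, hdesc⟩ := h.exists_θ_descent hP hγ hβ0 hβ2 hν hδ
  refine antitone_nat_of_succ_le fun k => ?_
  have : 0 ≤ c * stepLength x u z k ^ 2 := by positivity
  linarith [hdesc k]

lemma exists_tendsto_θ (hγ : 0 < γ) (hβ0 : 0 < β) (hβ2 : β < 2) (hν : 0 < ν)
    (hδ : δ = 2 * ν + L + 2 * ‖P.A‖ ^ 2 / γ) : ∃ θ₀, Tendsto θ atTop (𝓝 θ₀) :=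
  ⟨_, tendsto_atTop_ciInf (h.antitone_θ hP hγ hβ0 hβ2 hν hδ)
    ⟨0, by rintro _ ⟨k, rfl⟩; exact (h.θ_pos k).le⟩⟩

lemma tendsto_stepLength (hγ : 0 < γ) (hβ0 : 0 < β) (hβ2 : β < 2) (hν : 0 < ν)
    (hδ : δ = 2 * ν + L + 2 * ‖P.A‖ ^ 2 / γ) : Tendsto (stepLength x u z) atTop (𝓝 0) := by
  obtain ⟨c, hc, hdesc⟩ := h.exists_θ_descent hP hγ hβ0 hβ2 hν hδ
  obtain ⟨θ₀, hθ₀⟩ := h.exists_tendsto_θ hP hγ hβ0 hβ2 hν hδ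
  exact tendsto_zero_of_add_mul_sq_le hθ₀ hc (stepLength_nonneg x u z) hdesc

lemma tendsto_x_sub (hγ : 0 < γ) (hβ0 : 0 < β) (hβ2 : β < 2) (hν : 0 < ν)
    (hδ : δ = 2 * ν + L + 2 * ‖P.A‖ ^ 2 / γ) :
    Tendsto (fun k => x k - x (k + 1)) atTop (𝓝 0) :=
  squeeze_zero_norm (norm_x_sub_le_stepLength x u z)
    (h.tendsto_stepLength hP hγ hβ0 hβ2 hν hδ)

lemma exists_bound (hγ : 0 < γ) (hβ0 : 0 < β) (hβ2 : β < 2) (hν : 0 < ν)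
    (hδ : δ = 2 * ν + L + 2 * ‖P.A‖ ^ 2 / γ) :
    ∃ B, ∀ k, ‖x k‖ ≤ B ∧ ‖y (k + 1)‖ ≤ B ∧ ‖z k‖ ≤ B ∧ ‖u k‖ ≤ B := by
  obtain ⟨R₁, hR₁⟩ := hP.S_compact.isBounded.exists_norm_le
  obtain ⟨R₂, hR₂⟩ := hP.exists_subgradient_f_bound
  -- The sequence u is not confined to a compact set; it is bounded because u k - x (k + 1) is the
  -- u-step divided by β and the steps tend to zero.
  obtain ⟨R₃, hR₃⟩ := (h.tendsto_stepLength hP hγ hβ0 hβ2 hν hδ).bddAbove_range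
  refine ⟨max (max R₁ R₂) (max (ε / γ) (R₃ / β + R₁)), fun k => ⟨?_, ?_, ?_, ?_⟩⟩
  · exact (hR₁ _ (h.x_mem k)).trans ((le_max_left _ _).trans (le_max_left _ _))
  · exact (hR₂ _ (h.x_mem k) _ (h.y_mem k)).trans ((le_max_right _ _).trans (le_max_left _ _))
  · refine le_trans ?_ ((le_max_left _ _).trans (le_max_right _ _))
    rw [le_div_iff₀ hγ, mul_comm]
    exact h.z_le k
  · refine le_trans ?_ ((le_max_right _ _).trans (le_max_right _ _))
    have h1 : ‖u k - u (k + 1)‖ = β * ‖u k - x (k + 1)‖ := by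
      rw [h.u_sub_u k, norm_smul, Real.norm_of_nonneg hβ0.le]
    have h2 : β * ‖u k - x (k + 1)‖ ≤ R₃ :=
      h1 ▸ (norm_u_sub_le_stepLength x u z k).trans (hR₃ ⟨k, rfl⟩)
    have h3 : ‖u k - x (k + 1)‖ ≤ R₃ / β := by
      rw [le_div_iff₀ hβ0]; linarith
    have h4 := norm_add_le (u k - x (k + 1)) (x (k + 1))
    rw [sub_add_cancel] at h4
    linarith [hR₁ _ (h.x_mem (k + 1))]

end SteadyFSPS

end FracProgram

/-! ### Fréchet subgradients of the merit functions. -/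

section MeritSubgradients

lemma HasFDerivAt.exists_div_apply {W : Type*} [NormedAddCommGroup W] [NormedSpace ℝ W]
    {N D : W → ℝ} {N' D' : W →L[ℝ] ℝ} {a : W} (hN : HasFDerivAt N N' a) (hD : HasFDerivAt D D' a)
    (h0 : D a ≠ 0) :
    ∃ Q' : W →L[ℝ] ℝ, HasFDerivAt (fun w => N w / D w) Q' a ∧
      ∀ d, Q' d = (D a)⁻¹ * (N' d - N a / D a * D' d) := by
  have h1 := hN.mul ((hasDerivAt_inv h0).comp_hasFDerivAt a hD)
  refine ⟨_, h1, fun d => ?_⟩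
  simp only [_root_.add_apply, _root_.smul_apply, smul_eq_mul,
    Function.comp_apply]
  field_simp
  ring

lemma norm_toLp_prod_le {E F : Type*} [SeminormedAddCommGroup E] [SeminormedAddCommGroup F] (a : E)
    (b : F) : ‖(WithLp.toLp 2 (a, b) : WithLp 2 (E × F))‖ ≤ ‖a‖ + ‖b‖ := by
  rw [WithLp.prod_norm_eq_of_L2]
  refine Real.sqrt_le_iff.mpr ⟨by positivity, ?_⟩
  change ‖a‖ ^ 2 + ‖b‖ ^ 2 ≤ _
  nlinarith [mul_nonneg (norm_nonneg a) (norm_nonneg b)]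

lemma inner_toLp_prod_left {E F : Type*} [NormedAddCommGroup E] [InnerProductSpace ℝ E]
    [NormedAddCommGroup F] [InnerProductSpace ℝ F] (a : E) (b : F) (d : WithLp 2 (E × F)) :
    ⟪(WithLp.toLp 2 (a, b) : WithLp 2 (E × F)), d⟫ = ⟪a, d.fst⟫ + ⟪b, d.snd⟫ :=
  WithLp.prod_inner_apply _ _

lemma toLp_prod_smul_add {E F : Type*} [NormedAddCommGroup E] [InnerProductSpace ℝ E]
    [NormedAddCommGroup F] [InnerProductSpace ℝ F] (r : ℝ) (a c : E) (b : F) :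
    (WithLp.toLp 2 (r • (a + c), b) : WithLp 2 (E × F)) =
      WithLp.toLp 2 (r • a, b) + WithLp.toLp 2 (r • c, 0) := by
  rw [← WithLp.toLp_add, Prod.mk_add_mk, ← smul_add, add_zero]

lemma HasGradientAt.eq_of_mem_convSubdiff {E : Type*} [NormedAddCommGroup E]
    [InnerProductSpace ℝ E] [CompleteSpace E] {f : E → EReal} (hf : IsProper f) {a v b : E}
    (hd : HasGradientAt (fun x => (f x).toReal) b a) (hdom : effDom f ∈ 𝓝 a)
    (hv : v ∈ convSubdiff f a) : v = b := by
  have hmin : IsLocalMin (fun x => (f x).toReal - ⟪v, x⟫) a := by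
    filter_upwards [hdom] with x hx
    have := hf.subgradient_le hv hx
    rw [inner_sub_right] at this
    linarith
  have h1 := hmin.hasFDerivAt_eq_zero (hd.hasFDerivAt.sub (innerSL ℝ v).hasFDerivAt)
  refine ext_inner_right ℝ fun w => ?_
  have h2 := congrArg (fun T => T w) h1
  simp only [_root_.sub_apply, InnerProductSpace.toDual_apply_apply,
    _root_.zero_apply, innerSL_apply_apply] at h2
  linarith

namespace FracProgram

variable {n p s : ℕ} {P : FracProgram n p s} {L : ℝ≥0}

/-- No z-component appears: it is Ax - ∇g*(z) - γz, and ∇g*(z) = Ax - γz. Abstract coordinate maps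
let the formula serve both triples and quadruples. -/
lemma BasicAssumptions.exists_hasFDerivAt_psi (hP : P.BasicAssumptions L)
    (hg : IsEssStrictConvex P.g) {W : Type*} [NormedAddCommGroup W] [NormedSpace ℝ W]
    (px pu : W →L[ℝ] Eucl n) (pz : W →L[ℝ] Eucl s) {w : W} {γ : ℝ} (δ : ℝ) (hx : px w ∈ P.S)
    (hz : pz w ∈ convSubdiff P.g (P.A (px w) - γ • pz w)) :
    ∃ N' : W →L[ℝ] ℝ, HasFDerivAt (fun w => P.Psi (px w) (pz w) (pu w) δ γ) N' w ∧
      ∀ d, N' d = ⟪P.Aadj (pz w) + gradient P.h (px w) + δ • (px w - pu w), px d⟫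
        + ⟪-(δ • (px w - pu w)), pu d⟫ := by
  have hc := (hg.hasGradientAt_fenchelConj hP.g_pcl hz).hasFDerivAt.comp w pz.hasFDerivAt
  have hh := (hP.differentiableAt_h hx).hasGradientAt.hasFDerivAt.comp w px.hasFDerivAt
  have h1 := pz.hasFDerivAt.inner (𝕜 := ℝ) (P.A.comp px).hasFDerivAt (x := w)
  have h2 := ((px - pu).hasFDerivAt (x := w)).norm_sq.const_mul (δ / 2)
  have h3 := (pz.hasFDerivAt (x := w)).norm_sq.const_mul (γ / 2)
  refine ⟨_, (((h1.sub hc).add hh).add h2).sub h3, fun d => ?_⟩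
  simp only [_root_.sub_apply, _root_.add_apply,
    _root_.smul_apply, ContinuousLinearMap.comp_apply, fderivInnerCLM_apply,
    ContinuousLinearMap.prod_apply, InnerProductSpace.toDual_apply_apply, innerSL_apply_apply,
    smul_eq_mul, nsmul_eq_mul, inner_add_left, inner_sub_left, inner_sub_right, inner_neg_left,
    real_inner_smul_left, inner_Aadj_left, Nat.cast_ofNat, real_inner_comm (P.A (px w)) (pz d)]
  ring

lemma piMerit_eq (hg : IsProper P.g) {x u : Eucl n} {z w : Eucl s} (δ γ : ℝ) (hx : x ∈ P.S)
    (hz : z ∈ convSubdiff P.g w) :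
    P.PiMerit δ γ (WithLp.toLp 2 (x, WithLp.toLp 2 (z, u))) =
      ((P.Psi x z u δ γ / (P.f (P.K x)).toReal : ℝ) : EReal) :=
  if_pos ⟨hx, hg.mem_effDom_fenchelConj hz⟩

lemma gammaMerit_eq (hf : IsProper P.f) (hg : IsProper P.g) {x u : Eucl n} {y ξ : Eucl p}
    {z w : Eucl s} {m : ℝ} (δ γ : ℝ) (hx : x ∈ P.S) (hz : z ∈ convSubdiff P.g w)
    (hy : y ∈ convSubdiff P.f ξ) {D : ℝ} (hD : D = (P.f ξ).toReal + ⟪y, P.K x - ξ⟫)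
    (hmD : m / 2 < D) :
    P.GammaMerit m δ γ (WithLp.toLp 2 (x, WithLp.toLp 2 (y, WithLp.toLp 2 (z, u)))) =
      ((P.Psi x z u δ γ / D : ℝ) : EReal) := by
  have hy' : ⟪P.K x, y⟫ - (fenchelConj P.f y).toReal = D := by
    rw [hf.fenchelConj_toReal hy, hD, inner_sub_right, real_inner_comm y]
    ring
  rw [← hy'] at hmD ⊢
  exact if_pos ⟨hx, hf.mem_effDom_fenchelConj hy, hmD, hg.mem_effDom_fenchelConj hz⟩

/-- Fréchet subgradients of `Π`. -/
lemma BasicAssumptions.mem_frechetSubdiff_piMerit (hP : P.BasicAssumptions L)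
    (hg : IsEssStrictConvex P.g) {x u c : Eucl n} {z : Eucl s} {b : Eucl p} {γ : ℝ} (δ : ℝ)
    (hx : x ∈ P.S) (hz : z ∈ convSubdiff P.g (P.A x - γ • z))
    (hb : HasGradientAt (fun v => (P.f v).toReal) b (P.K x))
    (hc : ∀ v ∈ P.S, ⟪c, v - x⟫ ≤ 0) {ρ : ℝ}
    (hρ : ρ = P.Psi x z u δ γ / (P.f (P.K x)).toReal) :
    (WithLp.toLp 2 ((P.f (P.K x)).toReal⁻¹ •
        (P.Aadj z + gradient P.h x + δ • (x - u) - ρ • P.Kadj b + c),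
      WithLp.toLp 2 (0, -((P.f (P.K x)).toReal⁻¹ • δ • (x - u)))) : Triples n s) ∈
      frechetSubdiff (P.PiMerit δ γ)
        (WithLp.toLp 2 (x, WithLp.toLp 2 (z, u)) : Triples n s) := by
  set w₀ : Triples n s := WithLp.toLp 2 (x, WithLp.toLp 2 (z, u)) with hw₀
  set px : Triples n s →L[ℝ] Eucl n := WithLp.fstL 2 ℝ _ _ with hpx
  set pz : Triples n s →L[ℝ] Eucl s := (WithLp.fstL 2 ℝ _ _).comp (WithLp.sndL 2 ℝ _ _) with hpz
  set pu : Triples n s →L[ℝ] Eucl n := (WithLp.sndL 2 ℝ _ _).comp (WithLp.sndL 2 ℝ _ _) with hpu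
  set D := (P.f (P.K x)).toReal with hD
  have hD0 : 0 < D := hP.f_toReal_pos hx
  obtain ⟨N', hN', hN'd⟩ := hP.exists_hasFDerivAt_psi hg px pu pz (w := w₀) δ hx hz
  have hDd : HasFDerivAt (fun w => (P.f (P.K (px w))).toReal)
      ((InnerProductSpace.toDual ℝ _ b).comp (P.K.comp px)) w₀ :=
    HasFDerivAt.comp (g := fun v => (P.f v).toReal) (f := P.K.comp px) w₀ hb.hasFDerivAt
      (P.K.comp px).hasFDerivAt
  obtain ⟨Q', hQ', hQ'd⟩ := hN'.exists_div_apply hDd hD0.ne'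
  rw [toLp_prod_smul_add]
  refine add_mem_frechetSubdiff hQ' (fun d => ?_) ?_ ?_
  · rw [hQ'd, hN'd, inner_toLp_prod_left, inner_toLp_prod_left, inner_zero_left,
      real_inner_smul_left, inner_sub_left, real_inner_smul_left _ _ ρ, inner_Kadj_left,
      hρ]
    simp only [inner_neg_left, real_inner_smul_left]
    change D⁻¹ * (⟪P.Aadj z + gradient P.h x + δ • (x - u), d.fst⟫ + -(δ * ⟪x - u, d.snd.snd⟫)
      - P.Psi x z u δ γ / D * ⟪b, P.K d.fst⟫) = _
    ring
  · exact piMerit_eq hP.g_pcl.proper δ γ hx hz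
  · refine Eventually.of_forall fun w => ?_
    rw [inner_toLp_prod_left, inner_zero_left, add_zero, real_inner_smul_left]
    unfold PiMerit
    simp only
    split_ifs with hw
    · rw [EReal.coe_le_coe_iff]
      have h1 : D⁻¹ * ⟪c, (w - w₀).fst⟫ ≤ 0 :=
        mul_nonpos_of_nonneg_of_nonpos (by positivity) (hc _ hw.1)
      exact add_le_of_nonpos_right h1
    · exact le_top

/-- Derivative of the smooth minorant of Γ, whose denominator f(ξ) + ⟨y, Kx - ξ⟩ replaces ⟨Kx, y⟩ -
f*(y). -/
lemma BasicAssumptions.exists_hasFDerivAt_psi_div (hP : P.BasicAssumptions L)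
    (hg : IsEssStrictConvex P.g) {W : Type*} [NormedAddCommGroup W] [NormedSpace ℝ W]
    (px pu : W →L[ℝ] Eucl n) (py : W →L[ℝ] Eucl p) (pz : W →L[ℝ] Eucl s) {w : W} {γ : ℝ} (δ : ℝ)
    (hx : px w ∈ P.S) (hz : pz w ∈ convSubdiff P.g (P.A (px w) - γ • pz w)) (ξ : Eucl p) (C : ℝ)
    {D ρ : ℝ} (hD : D = C + ⟪py w, P.K (px w) - ξ⟫) (hD0 : D ≠ 0)
    (hρ : ρ = P.Psi (px w) (pz w) (pu w) δ γ / D) :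
    ContinuousAt (fun w => P.Psi (px w) (pz w) (pu w) δ γ) w ∧ ∃ Q' : W →L[ℝ] ℝ,
      HasFDerivAt (fun w => P.Psi (px w) (pz w) (pu w) δ γ / (C + ⟪py w, P.K (px w) - ξ⟫)) Q' w ∧
      ∀ d, Q' d =
        ⟪D⁻¹ • (P.Aadj (pz w) + gradient P.h (px w) + δ • (px w - pu w) - ρ • P.Kadj (py w)), px d⟫
        + ⟪-(D⁻¹ • ρ • (P.K (px w) - ξ)), py d⟫ + ⟪-(D⁻¹ • δ • (px w - pu w)), pu d⟫ := by
  obtain ⟨N', hN', hN'd⟩ := hP.exists_hasFDerivAt_psi hg px pu pz δ hx hz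
  have hden := ((py.hasFDerivAt (x := w)).inner (𝕜 := ℝ)
    ((P.K.comp px).hasFDerivAt.sub_const ξ)).const_add C
  obtain ⟨Q', hQ', hQ'd⟩ := hN'.exists_div_apply hden (hD ▸ hD0)
  refine ⟨hN'.continuousAt, Q', hQ', fun d => ?_⟩
  rw [hQ'd, hN'd]
  simp only [ContinuousLinearMap.comp_apply, fderivInnerCLM_apply,
    ContinuousLinearMap.prod_apply]
  rw [← hD, ← hρ, real_inner_smul_left, inner_sub_left, real_inner_smul_left _ _ ρ,
    inner_Kadj_left, real_inner_comm (P.K (px w) - ξ) (py d)]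
  simp only [inner_neg_left, real_inner_smul_left]
  ring

/-- Fréchet subgradients of `Γ` at points where the dual variable is a subgradient of `f`. -/
lemma BasicAssumptions.mem_frechetSubdiff_gammaMerit (hP : P.BasicAssumptions L)
    (hg : IsEssStrictConvex P.g) {x u c : Eucl n} {y ξ : Eucl p} {z : Eucl s} {m γ : ℝ} (δ : ℝ)
    (hm : 0 < m) (hx : x ∈ P.S) (hz : z ∈ convSubdiff P.g (P.A x - γ • z))
    (hy : y ∈ convSubdiff P.f ξ) {D : ℝ} (hD : D = (P.f ξ).toReal + ⟪y, P.K x - ξ⟫)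
    (hmD : m / 2 < D) (hpos : 0 < P.Psi x z u δ γ)
    (hc : ∀ v ∈ P.S, ⟪c, v - x⟫ ≤ 0) {ρ : ℝ} (hρ : ρ = P.Psi x z u δ γ / D) :
    (WithLp.toLp 2 (D⁻¹ • (P.Aadj z + gradient P.h x + δ • (x - u) - ρ • P.Kadj y + c),
      WithLp.toLp 2 (-(D⁻¹ • ρ • (P.K x - ξ)),
        WithLp.toLp 2 (0, -(D⁻¹ • δ • (x - u))))) : Quadruples n p s) ∈
      frechetSubdiff (P.GammaMerit m δ γ)
        (WithLp.toLp 2 (x, WithLp.toLp 2 (y, WithLp.toLp 2 (z, u))) : Quadruples n p s) := by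
  have hD0 : 0 < D := by linarith
  obtain ⟨hcont, Q', hQ', hQ'd⟩ := hP.exists_hasFDerivAt_psi_div hg
    (WithLp.fstL 2 ℝ (Eucl n) (WithLp 2 (Eucl p × WithLp 2 (Eucl s × Eucl n))))
    (((WithLp.sndL 2 ℝ _ _).comp (WithLp.sndL 2 ℝ _ _)).comp (WithLp.sndL 2 ℝ _ _))
    ((WithLp.fstL 2 ℝ _ _).comp (WithLp.sndL 2 ℝ _ _))
    (((WithLp.fstL 2 ℝ _ _).comp (WithLp.sndL 2 ℝ _ _)).comp (WithLp.sndL 2 ℝ _ _))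
    (w := (WithLp.toLp 2 (x, WithLp.toLp 2 (y, WithLp.toLp 2 (z, u))) : Quadruples n p s))
    δ hx hz ξ (P.f ξ).toReal hD hD0.ne' hρ
  rw [toLp_prod_smul_add]
  refine add_mem_frechetSubdiff hQ' (fun d => ?_) ?_ ?_
  · rw [hQ'd, inner_toLp_prod_left, inner_toLp_prod_left, inner_toLp_prod_left, inner_zero_left,
      zero_add, ← add_assoc]
    rfl
  · rw [gammaMerit_eq hP.f_pcl.proper hP.g_pcl.proper δ γ hx hz hy hD hmD, hD]
    rfl
  -- Only where Ψ stays positive does a smaller denominator give a larger quotient.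
  · filter_upwards [hcont.eventually_const_lt hpos] with w hw
    rw [inner_toLp_prod_left, inner_zero_left, add_zero, real_inner_smul_left]
    unfold GammaMerit
    simp only
    split_ifs with hdom
    · obtain ⟨hwx, hwy, hwm, -⟩ := hdom
      rw [EReal.coe_le_coe_iff]
      have h1 : D⁻¹ * ⟪c, w.fst - x⟫ ≤ 0 :=
        mul_nonpos_of_nonneg_of_nonpos (by positivity) (hc _ hwx)
      -- Fenchel–Young at ξ: the denominator of Γ is at most f(ξ) + ⟨y', Kx' - ξ⟩ at every nearby
      -- point of the domain, with equality at the base point.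
      have h2 := hP.f_pcl.proper.le_fenchelConj_toReal hy.1 hwy
      refine (add_le_of_nonpos_right h1).trans ?_
      refine div_le_div_of_nonneg_left hw.le (by linarith) ?_
      change _ ≤ (P.f ξ).toReal + ⟪w.snd.fst, P.K w.fst - ξ⟫
      rw [inner_sub_right, real_inner_comm w.snd.fst]
      linarith
    · exact le_top

end FracProgram

end MeritSubgradients

/-! ### Finite length of the steady iterates. -/

namespace FracProgram

variable {n p s : ℕ} {P : FracProgram n p s} {L : ℝ≥0}

lemma map_mem_Keps {ε : ℝ} (hε : 0 ≤ ε) {x : Eucl n} (hx : x ∈ P.S) : P.A x ∈ P.Keps ε := by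
  change Metric.infDist _ _ ≤ ε
  rwa [Metric.infDist_zero_of_mem (mem_image_of_mem P.A hx)]

namespace SteadyFSPS

variable {β δ γ ε ν : ℝ} {x : ℕ → Eucl n} {y : ℕ → Eucl p} {z : ℕ → Eucl s} {u : ℕ → Eucl n}
  {θ : ℕ → ℝ}

lemma tail (h : P.SteadyFSPS β δ γ ε x y z u θ) (N : ℕ) :
    P.SteadyFSPS β δ γ ε (fun k => x (k + N)) (fun k => y (k + N)) (fun k => z (k + N))
      (fun k => u (k + N)) (fun k => θ (k + N)) where
  x_mem k := h.x_mem _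
  y_mem k := by simpa only [Nat.add_right_comm k N 1] using h.y_mem (k + N)
  x_step k := by simpa only [Nat.add_right_comm k N 1] using h.x_step (k + N)
  u_step k := by simpa only [Nat.add_right_comm k N 1] using h.u_step (k + N)
  z_mem k := h.z_mem _
  z_le k := h.z_le _
  z_sq_le k := h.z_sq_le _
  θ_eq k := h.θ_eq _
  θ_pos k := h.θ_pos _

variable (hP : P.BasicAssumptions L) (h : P.SteadyFSPS β δ γ ε x y z u θ)
include hP h

/-- The `x`-component of the subgradients of the merit functions, up to a positive factor. -/
lemma norm_residual_le (hδ0 : 0 < δ) (k : ℕ) (ρ : ℝ) (y' : Eucl p) :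
    ‖P.Aadj (z (k + 1)) + gradient P.h (x (k + 1)) + δ • (x (k + 1) - u (k + 1)) - ρ • P.Kadj y'
      + normalVec P δ x y z u θ k‖ ≤ (‖P.A‖ + L + δ) * stepLength x u z k
        + ‖P.K‖ * (|θ k - ρ| * ‖y (k + 1)‖ + |ρ| * ‖y (k + 1) - y'‖) := by
  -- Adding the normal vector turns every term into a difference of consecutive iterates, apart from
  -- the mismatch between θ k and ρ.
  have hsplit : P.Aadj (z (k + 1)) + gradient P.h (x (k + 1)) + δ • (x (k + 1) - u (k + 1))
      - ρ • P.Kadj y' + normalVec P δ x y z u θ k =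
      P.Aadj (z (k + 1) - z k) + (gradient P.h (x (k + 1)) - gradient P.h (x k))
      + δ • (u k - u (k + 1)) + ((θ k - ρ) • P.Kadj (y (k + 1))
      + ρ • P.Kadj (y (k + 1) - y')) := by
    simp only [normalVec, map_sub]
    module
  have h1 := norm_Aadj_le (P := P) (z (k + 1) - z k)
  rw [norm_sub_rev (z (k + 1))] at h1
  have h2 := hP.lipschitzOn_gradient_h.norm_sub_le (h.x_mem (k + 1)) (h.x_mem k)
  rw [norm_sub_rev (x (k + 1))] at h2
  have h3 : ‖δ • (u k - u (k + 1))‖ = δ * ‖u k - u (k + 1)‖ := by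
    rw [norm_smul, Real.norm_of_nonneg hδ0.le]
  have h4 : ‖(θ k - ρ) • P.Kadj (y (k + 1))‖ ≤ |θ k - ρ| * (‖P.K‖ * ‖y (k + 1)‖) := by
    rw [norm_smul, Real.norm_eq_abs]
    gcongr
    exact norm_Kadj_le _
  have h5 : ‖ρ • P.Kadj (y (k + 1) - y')‖ ≤ |ρ| * (‖P.K‖ * ‖y (k + 1) - y'‖) := by
    rw [norm_smul, Real.norm_eq_abs]
    gcongr
    exact norm_Kadj_le _
  have h6 : ‖P.A‖ * ‖z k - z (k + 1)‖ ≤ ‖P.A‖ * stepLength x u z k := by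
    gcongr
    exact norm_z_sub_le_stepLength x u z k
  have h7 : L * ‖x k - x (k + 1)‖ ≤ L * stepLength x u z k := by
    gcongr
    exact norm_x_sub_le_stepLength x u z k
  have h8 : δ * ‖u k - u (k + 1)‖ ≤ δ * stepLength x u z k := by
    gcongr
    exact norm_u_sub_le_stepLength x u z k
  rw [hsplit]
  have h9 := norm_add₃_le (a := P.Aadj (z (k + 1) - z k))
    (b := gradient P.h (x (k + 1)) - gradient P.h (x k)) (c := δ • (u k - u (k + 1)))
  have h10 := norm_add_le ((θ k - ρ) • P.Kadj (y (k + 1))) (ρ • P.Kadj (y (k + 1) - y'))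
  refine (norm_add_le _ _).trans ?_
  linarith

omit hP in
lemma norm_x_sub_u_le (hβ0 : 0 < β) (hβ2 : β < 2) (k : ℕ) :
    ‖x (k + 1) - u (k + 1)‖ ≤ stepLength x u z k / β := by
  have h1 : ‖u k - u (k + 1)‖ = β * ‖u k - x (k + 1)‖ := by
    rw [h.u_sub_u k, norm_smul, Real.norm_of_nonneg hβ0.le]
  have h2 : |β - 1| ≤ 1 := abs_le.mpr ⟨by linarith, by linarith⟩
  rw [h.x_sub_u k, norm_smul, Real.norm_eq_abs, le_div_iff₀ hβ0]
  refine le_trans ?_ (norm_u_sub_le_stepLength x u z k)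
  rw [h1]
  nlinarith [mul_nonneg hβ0.le (norm_nonneg (u k - x (k + 1)))]

/-- Finite length under the KL property of `Π`. -/
lemma summable_of_piMerit (hg : IsEssStrictConvex P.g) (hγ : 0 < γ) (hβ0 : 0 < β) (hβ2 : β < 2)
    (hν : 0 < ν) (hδ : δ = 2 * ν + L + 2 * ‖P.A‖ ^ 2 / γ) (hε : 0 < ε)
    (hlip : HasLipschitzGradientNear P.f (P.K '' P.S))
    (hKL : ∀ w ∈ domLimitingSubdiff (P.PiMerit δ γ), P.A w.fst ∈ P.Keps ε →
      HasKLAt (P.PiMerit δ γ) w) :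
    Summable (stepLength x u z) := by
  have hδ0 : 0 < δ := by
    have := L.coe_nonneg
    have : 0 ≤ 2 * ‖P.A‖ ^ 2 / γ := by positivity
    linarith
  obtain ⟨O, Lf, hO, hSO, -, hfd, hfL⟩ := hlip
  have hgrad : ∀ v ∈ P.S, HasGradientAt (fun v => (P.f v).toReal)
      (gradient (fun v => (P.f v).toReal) (P.K v)) (P.K v) := fun v hv =>
    ((hfd _ (hSO ⟨v, hv, rfl⟩)).differentiableAt (hO.mem_nhds (hSO ⟨v, hv, rfl⟩))).hasGradientAt
  have hygrad : ∀ k, y (k + 1) = gradient (fun v => (P.f v).toReal) (P.K (x k)) := fun k =>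
    (hgrad _ (h.x_mem k)).eq_of_mem_convSubdiff hP.f_pcl.proper
      (mem_interior_iff_mem_nhds.mp (hP.KS_subset ⟨_, h.x_mem k, rfl⟩)) (h.y_mem k)
  obtain ⟨B, hB⟩ := h.exists_bound hP hγ hβ0 hβ2 hν hδ
  have hB0 : 0 ≤ B := (norm_nonneg _).trans (hB 0).1
  obtain ⟨m, hm, M, hmf⟩ := hP.exists_f_bounds
  obtain ⟨c, hc, hdesc⟩ := h.exists_θ_descent hP hγ hβ0 hβ2 hν hδ
  have hanti := h.antitone_θ hP hγ hβ0 hβ2 hν hδ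
  obtain ⟨θ₀, hθ₀⟩ := h.exists_tendsto_θ hP hγ hβ0 hβ2 hν hδ
  -- C₁ collects the coefficients of the step length and C₂ that of θ k - θ (k + 1).
  set C₁ := m⁻¹ * ((‖P.A‖ + L + δ) + ‖P.K‖ * (θ 0 * (Lf * ‖P.K‖)) + δ / β) with hC₁
  set C₂ := m⁻¹ * (‖P.K‖ * B) with hC₂
  have hθ00 := h.θ_pos 0
  have hC₁0 : 0 ≤ C₁ := by positivity
  have hC₂0 : 0 ≤ C₂ := by positivity
  refine summable_of_hasKLAt_of_frechetSubdiff (F := P.PiMerit δ γ)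
    (isCompact_closedBall (0 : Triples n s) (B + (B + B)))
    (w := fun k => WithLp.toLp 2 (x k, WithLp.toLp 2 (z k, u k))) (fun k => ?_) (r := θ)
    (C := C₁ + C₂) (fun k => ?_) hθ₀ hc (by positivity) (stepLength_nonneg x u z) hdesc
    (fun q ψ hψ hq => ?_) fun k => ?_
  · rw [mem_closedBall_zero_iff]
    refine (norm_toLp_prod_le _ _).trans (add_le_add (hB k).1 ?_)
    exact (norm_toLp_prod_le _ _).trans (add_le_add (hB k).2.2.1 (hB k).2.2.2)
  · rw [piMerit_eq hP.g_pcl.proper δ γ (h.x_mem k) (h.z_mem k), h.θ_eq k]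
  · have hx := ((WithLp.fstL 2 ℝ (Eucl n) (WithLp 2 (Eucl s × Eucl n))).continuous.tendsto q).comp hq
    have hzu := ((WithLp.sndL 2 ℝ (Eucl n) (WithLp 2 (Eucl s × Eucl n))).continuous.tendsto q).comp
      hq
    have hz := ((WithLp.fstL 2 ℝ (Eucl s) (Eucl n)).continuous.tendsto _).comp hzu
    have hu := ((WithLp.sndL 2 ℝ (Eucl s) (Eucl n)).continuous.tendsto _).comp hzu
    obtain ⟨hxS, hz₀, hΨ⟩ := hP.tendsto_psi δ (fun k => h.x_mem (ψ k)) (fun k => h.z_mem (ψ k))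
      hx hz hu
    have hf := hP.tendsto_f (fun k => h.x_mem (ψ k)) hxS hx
    have hlim := hΨ.div hf (hP.f_toReal_pos hxS).ne'
    have hlim' : Tendsto (fun k => θ (ψ k)) atTop (𝓝 θ₀) := hθ₀.comp hψ
    refine ⟨?_, fun hdom => hKL q hdom (map_mem_Keps hε.le hxS)⟩
    rw [← tendsto_nhds_unique (hlim.congr fun k => (h.θ_eq (ψ k)).symm) hlim']
    exact piMerit_eq hP.g_pcl.proper δ γ hxS hz₀
  · have hmem := hP.mem_frechetSubdiff_piMerit hg δ (h.x_mem (k + 1)) (h.z_mem (k + 1))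
      (hgrad _ (h.x_mem (k + 1))) (fun v hv => h.inner_normalVec_le hP hδ0 k hv) (h.θ_eq (k + 1))
    refine ⟨_, hmem, ?_⟩
    rw [← hygrad (k + 1)]
    have hD := (hmf _ (h.x_mem (k + 1))).1
    set D := (P.f (P.K (x (k + 1)))).toReal
    have hD0 : 0 < D := hm.trans_le hD
    have hDm : D⁻¹ ≤ m⁻¹ := inv_anti₀ hm hD
    have ha := stepLength_nonneg x u z k
    have hθk := hanti (Nat.le_succ k)
    have hy : ‖y (k + 1) - y (k + 1 + 1)‖ ≤ Lf * ‖P.K‖ * stepLength x u z k := by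
      rw [hygrad k, hygrad (k + 1)]
      refine (hfL.norm_sub_le (hSO ⟨_, h.x_mem k, rfl⟩) (hSO ⟨_, h.x_mem (k + 1), rfl⟩)).trans ?_
      rw [← map_sub, mul_assoc]
      gcongr
      refine (P.K.le_opNorm _).trans ?_
      gcongr
      exact norm_x_sub_le_stepLength x u z k
    have hres := h.norm_residual_le hP hδ0 k (θ (k + 1)) (y (k + 1 + 1))
    rw [abs_of_nonneg (by linarith : 0 ≤ θ k - θ (k + 1)), abs_of_pos (h.θ_pos (k + 1))] at hres
    have h1 : (θ k - θ (k + 1)) * ‖y (k + 1)‖ ≤ (θ k - θ (k + 1)) * B :=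
      mul_le_mul_of_nonneg_left (hB k).2.1 (by linarith)
    have h2 : θ (k + 1) * ‖y (k + 1) - y (k + 1 + 1)‖ ≤
        θ 0 * (Lf * ‖P.K‖ * stepLength x u z k) :=
      mul_le_mul (hanti (Nat.zero_le _)) hy (norm_nonneg _) hθ00.le
    have h3 : ‖P.K‖ * ((θ k - θ (k + 1)) * ‖y (k + 1)‖ + θ (k + 1) * ‖y (k + 1) - y (k + 1 + 1)‖)
        ≤ ‖P.K‖ * ((θ k - θ (k + 1)) * B + θ 0 * (Lf * ‖P.K‖ * stepLength x u z k)) := by gcongr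
    have h4 : δ * ‖x (k + 1) - u (k + 1)‖ ≤ δ * (stepLength x u z k / β) := by
      gcongr
      exact h.norm_x_sub_u_le hβ0 hβ2 k
    refine (norm_toLp_prod_le _ _).trans ?_
    refine (add_le_add_right (norm_toLp_prod_le _ _) _).trans ?_
    rw [norm_zero, zero_add, norm_neg, norm_smul, norm_smul D⁻¹, norm_smul δ,
      Real.norm_of_nonneg (inv_nonneg.mpr hD0.le), Real.norm_of_nonneg hδ0.le, ← mul_add]
    have hbr := add_le_add (hres.trans (add_le_add_right h3 _)) h4
    have h5 := mul_le_mul hDm hbr (by positivity) (by positivity : 0 ≤ m⁻¹)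
    refine h5.trans ?_
    have h6 : 0 ≤ C₁ * (θ k - θ (k + 1)) := mul_nonneg hC₁0 (by linarith)
    have h7 : 0 ≤ C₂ * stepLength x u z k := by positivity
    have h8 : m⁻¹ * ((‖P.A‖ + L + δ) * stepLength x u z k + ‖P.K‖ * ((θ k - θ (k + 1)) * B
        + θ 0 * (Lf * ‖P.K‖ * stepLength x u z k)) + δ * (stepLength x u z k / β)) =
        C₁ * stepLength x u z k + C₂ * (θ k - θ (k + 1)) := by
      rw [hC₁, hC₂]
      ring
    rw [h8]
    linarith

/-- Finite length under the KL property of `Γ`, for iterates at which the linearization of `f ∘ K`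
is bounded away from zero. -/
lemma summable_of_gammaMerit_of_lt (hg : IsEssStrictConvex P.g) (hγ : 0 < γ) (hβ0 : 0 < β)
    (hβ2 : β < 2) (hν : 0 < ν) (hδ : δ = 2 * ν + L + 2 * ‖P.A‖ ^ 2 / γ) (hε : 0 < ε) {m : ℝ}
    (hm : 0 < m) (hmf : ∀ k, m < (P.f (P.K (x k))).toReal)
    (hmD : ∀ k, m / 2 < (P.f (P.K (x k))).toReal + ⟪y (k + 1), P.K (x (k + 1) - x k)⟫)
    (hKL : ∀ w ∈ domLimitingSubdiff (P.GammaMerit m δ γ), P.A w.fst ∈ P.Keps ε →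
      HasKLAt (P.GammaMerit m δ γ) w) :
    Summable (stepLength x u z) := by
  have hδ0 : 0 < δ := by
    have := L.coe_nonneg
    have : 0 ≤ 2 * ‖P.A‖ ^ 2 / γ := by positivity
    linarith
  obtain ⟨B, hB⟩ := h.exists_bound hP hγ hβ0 hβ2 hν hδ
  have hB0 : 0 ≤ B := (norm_nonneg _).trans (hB 0).1
  obtain ⟨m', hm', M, hM⟩ := hP.exists_f_bounds
  have hM0 : 0 < M := hm'.trans_le ((hM _ (h.x_mem 0)).1.trans (hM _ (h.x_mem 0)).2)
  obtain ⟨c, hc, hdesc⟩ := h.exists_descent hP hγ hβ0 hβ2 hν hδ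
  have hanti := h.antitone_θ hP hγ hβ0 hβ2 hν hδ
  obtain ⟨θ₀, hθ₀⟩ := h.exists_tendsto_θ hP hγ hβ0 hβ2 hν hδ
  have hθ00 := h.θ_pos 0
  set D : ℕ → ℝ := fun k => (P.f (P.K (x k))).toReal + ⟪y (k + 1), P.K (x (k + 1) - x k)⟫ with hD
  have hDpos : ∀ k, 0 < D k := fun k => (half_pos hm).trans (hmD k)
  -- Value of Γ at the iterate with index k + 1: since y (k + 1) is a subgradient at K (x k), the
  -- denominator of Γ there is D k.
  set G : ℕ → ℝ := fun k => P.Psi (x (k + 1)) (z (k + 1)) (u (k + 1)) δ γ / D k with hG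
  have hG0 : ∀ k, 0 < G k := fun k => div_pos (h.psi_pos hP (k + 1)) (hDpos k)
  have hθG : ∀ k, θ (k + 1) ≤ G k := fun k => by
    rw [h.θ_eq (k + 1)]
    exact div_le_div_of_nonneg_left (h.psi_pos hP (k + 1)).le (hDpos k) (h.linearization_le hP k)
  have hGθ : ∀ k, G k + c / M * stepLength x u z k ^ 2 ≤ θ k := by
    intro k
    have h1 := hdesc k
    have h2 : D k ≤ M := (h.linearization_le hP k).trans (hM _ (h.x_mem (k + 1))).2
    have h3 : c / M * stepLength x u z k ^ 2 * D k ≤ c * stepLength x u z k ^ 2 := by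
      calc c / M * stepLength x u z k ^ 2 * D k ≤ c / M * stepLength x u z k ^ 2 * M := by gcongr
        _ = c * stepLength x u z k ^ 2 := by field_simp
    have h4 : G k * D k = P.Psi (x (k + 1)) (z (k + 1)) (u (k + 1)) δ γ :=
      div_mul_cancel₀ _ (hDpos k).ne'
    refine le_of_mul_le_mul_right ?_ (hDpos k)
    change _ ≤ θ k * D k
    change _ ≤ θ k * D k at h1
    linarith
  have hGθ' : ∀ k, G k ≤ θ k := fun k => by
    have : 0 ≤ c / M * stepLength x u z k ^ 2 := by positivity
    linarith [hGθ k]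
  have hGlim : Tendsto G atTop (𝓝 θ₀) :=
    tendsto_of_tendsto_of_tendsto_of_le_of_le (hθ₀.comp (tendsto_add_atTop_nat 1)) hθ₀ hθG hGθ'
  set C₁ := (m / 2)⁻¹ * ((‖P.A‖ + L + δ) + θ 0 * ‖P.K‖ + δ / β) with hC₁
  set C₂ := (m / 2)⁻¹ * (‖P.K‖ * B) with hC₂
  have hC₁0 : 0 ≤ C₁ := by positivity
  have hC₂0 : 0 ≤ C₂ := by positivity
  -- The index shifts because the drop from G k to G (k + 1) passes through θ (k + 1) and so
  -- controls the step of index k + 1.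
  rw [← summable_nat_add_iff 1]
  refine summable_of_hasKLAt_of_frechetSubdiff (F := P.GammaMerit m δ γ)
    (isCompact_closedBall (0 : Quadruples n p s) (B + (B + (B + B))))
    (w := fun k => WithLp.toLp 2 (x (k + 1), WithLp.toLp 2 (y (k + 1),
      WithLp.toLp 2 (z (k + 1), u (k + 1))))) (fun k => ?_) (r := G)
    (c := c / M) (C := C₁ + C₂) (fun k => ?_) hGlim (by positivity) (by positivity)
    (fun k => stepLength_nonneg x u z (k + 1)) (fun k => (hGθ (k + 1)).trans (hθG k))
    (fun q ψ hψ hq => ?_) fun k => ?_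
  · rw [mem_closedBall_zero_iff]
    refine (norm_toLp_prod_le _ _).trans (add_le_add (hB (k + 1)).1 ?_)
    refine (norm_toLp_prod_le _ _).trans (add_le_add (hB k).2.1 ?_)
    exact (norm_toLp_prod_le _ _).trans (add_le_add (hB (k + 1)).2.2.1 (hB (k + 1)).2.2.2)
  · exact gammaMerit_eq hP.f_pcl.proper hP.g_pcl.proper δ γ (h.x_mem (k + 1)) (h.z_mem (k + 1))
      (h.y_mem k) (by simp only [hD, map_sub]) (hmD k)
  · have hx := ((WithLp.fstL 2 ℝ (Eucl n)
      (WithLp 2 (Eucl p × WithLp 2 (Eucl s × Eucl n)))).continuous.tendsto q).comp hq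
    have hyzu := ((WithLp.sndL 2 ℝ (Eucl n)
      (WithLp 2 (Eucl p × WithLp 2 (Eucl s × Eucl n)))).continuous.tendsto q).comp hq
    have hy := ((WithLp.fstL 2 ℝ (Eucl p) (WithLp 2 (Eucl s × Eucl n))).continuous.tendsto _).comp
      hyzu
    have hzu := ((WithLp.sndL 2 ℝ (Eucl p) (WithLp 2 (Eucl s × Eucl n))).continuous.tendsto _).comp
      hyzu
    have hz := ((WithLp.fstL 2 ℝ (Eucl s) (Eucl n)).continuous.tendsto _).comp hzu
    have hu := ((WithLp.sndL 2 ℝ (Eucl s) (Eucl n)).continuous.tendsto _).comp hzu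
    change Tendsto (fun k => x (ψ k + 1)) atTop (𝓝 q.fst) at hx
    change Tendsto (fun k => y (ψ k + 1)) atTop (𝓝 q.snd.fst) at hy
    obtain ⟨hxS, hz₀, hΨ⟩ := hP.tendsto_psi δ (fun k => h.x_mem (ψ k + 1))
      (fun k => h.z_mem (ψ k + 1)) hx hz hu
    -- The subgradient y (ψ k + 1) belongs to x (ψ k), while the cluster point involves x (ψ k + 1);
    -- vanishing steps reconcile the two.
    have hdx : Tendsto (fun k => x (ψ k) - x (ψ k + 1)) atTop (𝓝 0) :=
      (h.tendsto_x_sub hP hγ hβ0 hβ2 hν hδ).comp hψ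
    have hx' : Tendsto (fun k => x (ψ k)) atTop (𝓝 q.fst) := by
      simpa using hdx.add hx
    obtain ⟨hy₀, hf⟩ := hP.f_pcl.mem_convSubdiff_of_tendsto (fun k => h.y_mem (ψ k))
      ((P.K.continuous.tendsto _).comp hx') hy
    have hDlim : Tendsto (fun k => D (ψ k)) atTop (𝓝 (P.f (P.K q.fst)).toReal) := by
      have := hf.add (hy.inner ((P.K.continuous.tendsto _).comp (hx.sub hx')) (𝕜 := ℝ))
      simpa [hD] using this
    have hlim := hΨ.div hDlim (hP.f_toReal_pos hxS).ne'
    have hlim' : Tendsto (fun k => G (ψ k)) atTop (𝓝 θ₀) := hGlim.comp hψ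
    have hmq : m ≤ (P.f (P.K q.fst)).toReal :=
      ge_of_tendsto hf (Eventually.of_forall fun k => (hmf (ψ k)).le)
    refine ⟨?_, fun hdom => hKL q hdom (map_mem_Keps hε.le hxS)⟩
    rw [← tendsto_nhds_unique hlim hlim']
    exact gammaMerit_eq hP.f_pcl.proper hP.g_pcl.proper δ γ hxS hz₀ hy₀
      (by rw [sub_self, inner_zero_right, add_zero]) (by linarith)
  · have hDeq : D (k + 1) = (P.f (P.K (x (k + 1)))).toReal
        + ⟪y (k + 1 + 1), P.K (x (k + 1 + 1)) - P.K (x (k + 1))⟫ := by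
      simp only [hD, map_sub]
    have hmem := hP.mem_frechetSubdiff_gammaMerit hg δ hm (h.x_mem (k + 1 + 1))
      (h.z_mem (k + 1 + 1)) (h.y_mem (k + 1)) hDeq (hmD (k + 1)) (h.psi_pos hP (k + 1 + 1))
      (fun v hv => h.inner_normalVec_le hP hδ0 (k + 1) hv) (ρ := G (k + 1)) rfl
    refine ⟨_, hmem, ?_⟩
    have hD0 := hDpos (k + 1)
    have hDm : (D (k + 1))⁻¹ ≤ (m / 2)⁻¹ := inv_anti₀ (half_pos hm) (hmD (k + 1)).le
    have ha := stepLength_nonneg x u z (k + 1)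
    -- The mismatch between the multiplier θ used by the algorithm and the value of Γ is absorbed by
    -- the decrease of Γ.
    have hrr : θ (k + 1) - G (k + 1) ≤ G k - G (k + 1) := by linarith [hθG k]
    have hr0 : 0 ≤ θ (k + 1) - G (k + 1) := by linarith [hGθ' (k + 1)]
    have hGle : G (k + 1) ≤ θ 0 := (hGθ' (k + 1)).trans (hanti (Nat.zero_le _))
    have hres := h.norm_residual_le hP hδ0 (k + 1) (G (k + 1)) (y (k + 1 + 1))
    rw [abs_of_nonneg hr0, sub_self (y (k + 1 + 1)), norm_zero, mul_zero, add_zero] at hres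
    have h1 : (θ (k + 1) - G (k + 1)) * ‖y (k + 1 + 1)‖ ≤ (G k - G (k + 1)) * B :=
      mul_le_mul hrr (hB (k + 1)).2.1 (norm_nonneg _) (hr0.trans hrr)
    have h3 : ‖P.K‖ * ((θ (k + 1) - G (k + 1)) * ‖y (k + 1 + 1)‖) ≤
        ‖P.K‖ * ((G k - G (k + 1)) * B) := by gcongr
    have h4 : δ * ‖x (k + 1 + 1) - u (k + 1 + 1)‖ ≤ δ * (stepLength x u z (k + 1) / β) := by
      gcongr
      exact h.norm_x_sub_u_le hβ0 hβ2 (k + 1)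
    have h2 : G (k + 1) * ‖P.K (x (k + 1 + 1)) - P.K (x (k + 1))‖ ≤
        θ 0 * (‖P.K‖ * stepLength x u z (k + 1)) := by
      refine mul_le_mul hGle ?_ (norm_nonneg _) hθ00.le
      rw [← map_sub]
      refine (P.K.le_opNorm _).trans ?_
      rw [norm_sub_rev]
      gcongr
      exact norm_x_sub_le_stepLength x u z (k + 1)
    refine (norm_toLp_prod_le _ _).trans ?_
    refine (add_le_add_right ((norm_toLp_prod_le _ _).trans
      (add_le_add_right (norm_toLp_prod_le _ _) _)) _).trans ?_
    rw [norm_zero, zero_add, norm_neg, norm_neg, norm_smul, norm_smul (D (k + 1))⁻¹,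
      norm_smul (G (k + 1)), norm_smul (D (k + 1))⁻¹, norm_smul δ,
      Real.norm_of_nonneg (inv_nonneg.mpr hD0.le), Real.norm_of_nonneg hδ0.le,
      Real.norm_of_nonneg (hG0 (k + 1)).le, ← mul_add, ← mul_add]
    have hbr := add_le_add (hres.trans (add_le_add_right h3 _)) (add_le_add h2 h4)
    have hnn : 0 ≤ G (k + 1) * ‖P.K (x (k + 1 + 1)) - P.K (x (k + 1))‖ :=
      mul_nonneg (hG0 _).le (norm_nonneg _)
    have h5 := mul_le_mul hDm hbr (by positivity) (by positivity : 0 ≤ (m / 2)⁻¹)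
    refine h5.trans ?_
    have h6 : 0 ≤ C₁ * (G k - G (k + 1)) := mul_nonneg hC₁0 (hr0.trans hrr)
    have h7 : 0 ≤ C₂ * stepLength x u z (k + 1) := by positivity
    have h8 : (m / 2)⁻¹ * ((‖P.A‖ + L + δ) * stepLength x u z (k + 1)
        + ‖P.K‖ * ((G k - G (k + 1)) * B) + (θ 0 * (‖P.K‖ * stepLength x u z (k + 1))
        + δ * (stepLength x u z (k + 1) / β))) =
        C₁ * stepLength x u z (k + 1) + C₂ * (G k - G (k + 1)) := by
      rw [hC₁, hC₂]
      ring
    rw [h8]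
    linarith

/-- Finite length under the KL property of `Γ`. -/
lemma summable_of_gammaMerit (hg : IsEssStrictConvex P.g) (hγ : 0 < γ) (hβ0 : 0 < β)
    (hβ2 : β < 2) (hν : 0 < ν) (hδ : δ = 2 * ν + L + 2 * ‖P.A‖ ^ 2 / γ) (hε : 0 < ε) {m : ℝ}
    (hm : 0 < m) (hmf : ∀ k, m < (P.f (P.K (x k))).toReal)
    (hKL : ∀ w ∈ domLimitingSubdiff (P.GammaMerit m δ γ), P.A w.fst ∈ P.Keps ε →
      HasKLAt (P.GammaMerit m δ γ) w) :
    Summable (stepLength x u z) := by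
  obtain ⟨B, hB⟩ := h.exists_bound hP hγ hβ0 hβ2 hν hδ
  have hlim : Tendsto (fun k => B * (‖P.K‖ * ‖x k - x (k + 1)‖)) atTop (𝓝 0) := by
    have := ((h.tendsto_x_sub hP hγ hβ0 hβ2 hν hδ).norm.const_mul ‖P.K‖).const_mul B
    simpa using this
  -- From N on, D k differs from f(Kx_k) > m by less than m/2; the earlier terms are dropped.
  obtain ⟨N, hN⟩ := eventually_atTop.mp (hlim.eventually_lt_const (half_pos hm))
  have hmD : ∀ k, N ≤ k →
      m / 2 < (P.f (P.K (x k))).toReal + ⟪y (k + 1), P.K (x (k + 1) - x k)⟫ := by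
    intro k hk
    have h1 := neg_le_of_abs_le (abs_real_inner_le_norm (y (k + 1)) (P.K (x (k + 1) - x k)))
    have h2 : ‖y (k + 1)‖ * ‖P.K (x (k + 1) - x k)‖ ≤ B * (‖P.K‖ * ‖x k - x (k + 1)‖) := by
      refine mul_le_mul (hB k).2.1 ?_ (norm_nonneg _) ((norm_nonneg _).trans (hB k).1)
      rw [norm_sub_rev]
      exact P.K.le_opNorm _
    linarith [hN k hk, hmf k]
  have hsum := (h.tail N).summable_of_gammaMerit_of_lt hP hg hγ hβ0 hβ2 hν hδ hε hm
    (fun k => hmf (k + N)) (fun k => by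
      have := hmD (k + N) (by omega)
      rwa [Nat.add_right_comm k N 1] at this) hKL
  rw [← summable_nat_add_iff N]
  refine hsum.congr fun k => ?_
  simp only [stepLength, Nat.add_right_comm k N 1]

end SteadyFSPS

end FracProgram

/-! ### The limit point and its approximate stationarity. -/

namespace FracProgram

variable {n p s : ℕ} {P : FracProgram n p s} {L : ℝ≥0}

lemma BasicAssumptions.isCompact_Keps (hP : P.BasicAssumptions L) (ε : ℝ) :
    IsCompact (P.Keps ε) := by
  have hc : IsCompact (P.A '' P.S) := hP.S_compact.image P.A.continuous
  refine Metric.isCompact_of_isClosed_isBounded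
    (isClosed_le (Metric.continuous_infDist_pt _) continuous_const) ?_
  obtain ⟨R, hR⟩ := hc.isBounded.exists_norm_le
  refine isBounded_iff_forall_norm_le.mpr ⟨ε + R, fun w hw => ?_⟩
  obtain ⟨v, hv, hvd⟩ := hc.exists_infDist_eq_dist (hP.S_nonempty.image P.A) w
  have h1 : dist w v ≤ ε := hvd ▸ hw
  rw [dist_eq_norm] at h1
  have h2 := norm_add_le (w - v) v
  rw [sub_add_cancel] at h2
  linarith [hR v hv]

lemma BasicAssumptions.exists_lipschitzOnWith_Keps (hP : P.BasicAssumptions L) {ε : ℝ}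
    (hKeps : P.Keps ε ⊆ interior (effDom P.g)) :
    ∃ κ : ℝ≥0, 0 < κ ∧ LipschitzOnWith κ (fun w => (P.g w).toReal) (P.Keps ε) := by
  obtain ⟨κ, hκ⟩ := (hP.g_pcl.convex.locallyLipschitzOn_interior.mono
    hKeps).exists_lipschitzOnWith_of_compact (hP.isCompact_Keps ε)
  exact ⟨κ + 1, by positivity, hκ.weaken (by simp)⟩

/-- The properties of a limit point of the algorithm from which stationarity is derived. -/
structure IsSteadyLimit (P : FracProgram n p s) (δ γ ε : ℝ) (x : Eucl n) (y : Eucl p) (z : Eucl s) :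
    Prop where
  x_mem : x ∈ P.S
  y_mem : y ∈ convSubdiff P.f (P.K x)
  z_mem : z ∈ convSubdiff P.g (P.A x - γ • z)
  z_le : γ * ‖z‖ ≤ ε
  z_sq_le : γ / 2 * ‖z‖ ^ 2 ≤ ε
  normal : ∀ v ∈ P.S, ⟪(P.Psi x z x δ γ / (P.f (P.K x)).toReal) • P.Kadj y - gradient P.h x
    - P.Aadj z, v - x⟫ ≤ 0

/-- Finite length makes x and z Cauchy; u has the limit of x because u k - x (k + 1) tends to zero,
so the proximal term vanishes in the limit. Only y requires a subsequence. -/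
lemma SteadyFSPS.exists_limit {β δ γ ε : ℝ} {x : ℕ → Eucl n} {y : ℕ → Eucl p}
    {z : ℕ → Eucl s} {u : ℕ → Eucl n} {θ : ℕ → ℝ} (hP : P.BasicAssumptions L)
    (h : P.SteadyFSPS β δ γ ε x y z u θ) (hβ : β ≠ 0) (hδ0 : 0 < δ)
    (hsum : Summable (stepLength x u z)) :
    ∃ x₀ y₀ z₀, Tendsto x atTop (𝓝 x₀) ∧ P.IsSteadyLimit δ γ ε x₀ y₀ z₀ := by
  obtain ⟨x₀, hx₀⟩ := cauchySeq_tendsto_of_complete (cauchySeq_of_summable_dist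
    (hsum.of_nonneg_of_le (fun _ => dist_nonneg) fun k =>
      (dist_eq_norm (x k) (x (k + 1))).trans_le (norm_x_sub_le_stepLength x u z k)))
  obtain ⟨z₀, hz₀⟩ := cauchySeq_tendsto_of_complete (cauchySeq_of_summable_dist
    (hsum.of_nonneg_of_le (fun _ => dist_nonneg) fun k =>
      (dist_eq_norm (z k) (z (k + 1))).trans_le (norm_z_sub_le_stepLength x u z k)))
  have hx₁ : Tendsto (fun k => x (k + 1)) atTop (𝓝 x₀) := hx₀.comp (tendsto_add_atTop_nat 1)
  have hdu : Tendsto (fun k => u k - u (k + 1)) atTop (𝓝 0) :=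
    squeeze_zero_norm (norm_u_sub_le_stepLength x u z) hsum.tendsto_atTop_zero
  have hux : Tendsto (fun k => u k - x (k + 1)) atTop (𝓝 0) := by
    have := hdu.const_smul β⁻¹
    rw [smul_zero] at this
    refine this.congr fun k => ?_
    rw [h.u_sub_u k, smul_smul, inv_mul_cancel₀ hβ, one_smul]
  have hu₀ : Tendsto u atTop (𝓝 x₀) := by
    simpa using hux.add hx₁
  obtain ⟨R, hR⟩ := hP.exists_subgradient_f_bound
  obtain ⟨y₀, -, ψ, hψ, hy₀⟩ := (isCompact_closedBall (0 : Eucl p) R).tendsto_subseq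
    (x := fun k => y (k + 1)) fun k => by
      rw [mem_closedBall_zero_iff]; exact hR _ (h.x_mem k) _ (h.y_mem k)
  obtain ⟨hxS, hz₀', hΨ⟩ := hP.tendsto_psi δ h.x_mem h.z_mem hx₀ hz₀ hu₀
  have hf := hP.tendsto_f h.x_mem hxS hx₀
  obtain ⟨hy₀', -⟩ := hP.f_pcl.mem_convSubdiff_of_tendsto (fun k => h.y_mem (ψ k))
    ((P.K.continuous.tendsto x₀).comp (hx₀.comp hψ.tendsto_atTop)) hy₀
  have hθ : Tendsto θ atTop (𝓝 (P.Psi x₀ z₀ x₀ δ γ / (P.f (P.K x₀)).toReal)) :=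
    (hΨ.div hf (hP.f_toReal_pos hxS).ne').congr fun k => (h.θ_eq k).symm
  have hgrad : Tendsto (fun k => gradient P.h (x k)) atTop (𝓝 (gradient P.h x₀)) :=
    (hP.lipschitzOn_gradient_h.continuousOn x₀ hxS).tendsto.comp
      (tendsto_nhdsWithin_iff.mpr ⟨hx₀, Eventually.of_forall h.x_mem⟩)
  refine ⟨x₀, y₀, z₀, hx₀, hxS, hy₀', hz₀', ?_, ?_, fun v hv => ?_⟩
  · exact le_of_tendsto (hz₀.norm.const_mul γ) (Eventually.of_forall h.z_le)
  · exact le_of_tendsto ((hz₀.norm.pow 2).const_mul (γ / 2)) (Eventually.of_forall h.z_sq_le)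
  · have hψt := hψ.tendsto_atTop
    have hN : Tendsto (fun k => normalVec P δ x y z u θ (ψ k)) atTop
        (𝓝 (δ • (0 : Eucl n) + (P.Psi x₀ z₀ x₀ δ γ / (P.f (P.K x₀)).toReal) • P.Kadj y₀
          - gradient P.h x₀ - P.Aadj z₀)) :=
      ((((hux.comp hψt).const_smul δ).add ((hθ.comp hψt).smul
        ((P.Kadj.continuous.tendsto y₀).comp hy₀))).sub (hgrad.comp hψt)).sub
        ((P.Aadj.continuous.tendsto z₀).comp (hz₀.comp hψt))
    rw [smul_zero, zero_add] at hN
    exact le_of_tendsto (hN.inner (tendsto_const_nhds.sub (hx₁.comp hψt)))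
      (Eventually.of_forall fun k => h.inner_normalVec_le hP hδ0 (ψ k) hv)

lemma mem_convSubdiff_indicatorFn {E : Type*} [NormedAddCommGroup E] [InnerProductSpace ℝ E]
    {C : Set E} {a c : E} (ha : a ∈ C) (hc : ∀ v ∈ C, ⟪c, v - a⟫ ≤ 0) :
    c ∈ convSubdiff (indicatorFn C) a := by
  have ha0 : indicatorFn C a = 0 := if_pos ha
  refine ⟨mem_effDom_of_eq_coe (r := 0) ha0, fun v => ?_⟩
  rw [ha0, zero_add, sub_zero]
  by_cases hv : v ∈ C
  · rw [show indicatorFn C v = ((0 : ℝ) : EReal) from if_pos hv, EReal.coe_le_coe_iff]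
    exact hc v hv
  · rw [show indicatorFn C v = ⊤ from if_neg hv]
    exact le_top

namespace IsSteadyLimit

variable {δ γ ε : ℝ} {x : Eucl n} {y : Eucl p} {z : Eucl s} (hP : P.BasicAssumptions L)
  (h : P.IsSteadyLimit δ γ ε x y z)
include hP h

/-- The lifted value is Ψ = g(Ax - γz) + (γ/2)‖z‖² + h(x). The subgradient inequality at Ax - γz
gives Ψ ≤ g(Ax) + h(x); the hypothesis on η bounds Ψ from below up to (γ/2)‖z‖² ≤ ε and makes z an
η-subgradient at `A x`. -/
lemma isLiftedStationary (hγ : 0 < γ) (hA : P.A x ∈ effDom P.g) {η : ℝ}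
    (hη : (P.g (P.A x)).toReal - η ≤ (P.g (P.A x - γ • z)).toReal + γ * ‖z‖ ^ 2) :
    P.IsLiftedStationary η (η + ε) x := by
  have hg := hP.g_pcl.proper
  have hf := hP.f_toReal_pos h.x_mem
  have hΨ : P.Psi x z x δ γ =
      (P.g (P.A x - γ • z)).toReal + γ / 2 * ‖z‖ ^ 2 + P.h x := by
    simp only [Psi, sub_self, norm_zero]
    rw [hg.fenchelConj_toReal h.z_mem, inner_sub_right, inner_smul_right,
      real_inner_self_eq_norm_sq]
    ring
  refine ⟨P.Psi x z x δ γ, ?_, z, ?_, _, mem_convSubdiff_indicatorFn h.x_mem h.normal, y, h.y_mem,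
    ?_⟩
  · have h1 := hg.subgradient_le h.z_mem hA
    rw [sub_sub_cancel, inner_smul_right, real_inner_self_eq_norm_sq] at h1
    have h2 : 0 ≤ γ * ‖z‖ ^ 2 := by positivity
    have h3 := h.z_sq_le
    rw [hΨ, abs_le]
    constructor <;> linarith
  · refine hg.mem_epsSubdiff hA fun v hv => ?_
    have h1 := hg.subgradient_le h.z_mem hv
    have h2 : v - (P.A x - γ • z) = (v - P.A x) + γ • z := by abel
    rw [h2, inner_add_right, inner_smul_right, real_inner_self_eq_norm_sq] at h1
    linarith
  · have h1 : P.Aadj z + gradient P.h x + ((P.Psi x z x δ γ / (P.f (P.K x)).toReal) • P.Kadj y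
        - gradient P.h x - P.Aadj z) = (P.Psi x z x δ γ / (P.f (P.K x)).toReal) • P.Kadj y := by
      abel
    rw [h1, smul_smul, mul_div_cancel₀ _ hf.ne', sub_self]

lemma isLiftedStationary_of_lipschitzOnWith (hγ : 0 < γ) (hε : 0 < ε)
    (hA : P.A x ∈ effDom P.g) {κ : ℝ≥0}
    (hκ : LipschitzOnWith κ (fun w => (P.g w).toReal) (P.Keps ε)) :
    P.IsLiftedStationary (2 * κ * ε) ((2 * κ + 1) * ε) x := by
  have hd : ‖P.A x - (P.A x - γ • z)‖ ≤ ε := by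
    rw [sub_sub_cancel, norm_smul, Real.norm_of_nonneg hγ.le]
    exact h.z_le
  have hw : P.A x - γ • z ∈ P.Keps ε :=
    (Metric.infDist_le_dist_of_mem (mem_image_of_mem P.A h.x_mem)).trans
      (by rwa [dist_comm, dist_eq_norm])
  have h1 := hκ.norm_sub_le (map_mem_Keps hε.le h.x_mem) hw
  have h2 := (le_abs_self _).trans h1
  have h3 : κ * ‖P.A x - (P.A x - γ • z)‖ ≤ κ * ε := by gcongr
  have h4 : 0 ≤ κ * ε := by positivity
  have h5 : 0 ≤ γ * ‖z‖ ^ 2 := by positivity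
  -- Already κε would do for η.
  have := h.isLiftedStationary hP hγ hA (η := 2 * κ * ε) (by linarith)
  rwa [show (2 * κ + 1) * ε = 2 * κ * ε + ε by ring]

/-- Here z = ∇g(Ax - γz), and the descent lemma from Ax - γz to Ax produces the term γ‖z‖² and a
remainder of at most Lg ε²/2. -/
lemma isLiftedStationary_of_lipschitzWith_gradient (hγ : 0 < γ) (hg : ∀ w, P.g w ≠ ⊤) {Lg : ℝ≥0}
    (hd : Differentiable ℝ fun w => (P.g w).toReal)
    (hL : LipschitzWith Lg (gradient fun w => (P.g w).toReal)) :
    P.IsLiftedStationary (Lg * ε ^ 2 / 2) (Lg * ε ^ 2 / 2 + ε) x := by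
  have hdom : ∀ w, w ∈ effDom P.g := fun w => lt_top_iff_ne_top.mpr (hg w)
  have hz := (hd (P.A x - γ • z)).hasGradientAt.eq_of_mem_convSubdiff hP.g_pcl.proper
    (univ_mem' hdom) h.z_mem
  have h1 := le_add_inner_gradient_add_sq convex_univ (fun w _ => hd w)
    (lipschitzOnWith_univ.mpr hL) (mem_univ (P.A x - γ • z)) (mem_univ (P.A x))
  rw [← hz, sub_sub_cancel, inner_smul_right, real_inner_self_eq_norm_sq, norm_smul,
    Real.norm_of_nonneg hγ.le] at h1
  have h2 : (Lg : ℝ) / 2 * (γ * ‖z‖) ^ 2 ≤ Lg / 2 * ε ^ 2 := by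
    gcongr
    exact h.z_le
  exact h.isLiftedStationary hP hγ (hdom _) (by linarith)

end IsSteadyLimit

end FracProgram

/-! ### Stabilization of the smoothing parameter. -/

namespace FracProgram

variable {n p s : ℕ} {P : FracProgram n p s} {L : ℝ≥0}

lemma SubgradientBound.exists_bound (h : P.SubgradientBound) :
    ∃ l > 0, ∀ x ∈ P.S, ∃ v ∈ convSubdiff P.g (P.A x), ‖v‖ ≤ l := by
  obtain ⟨hne, l, hl, hb⟩ := h
  -- The slack 1 avoids having to attain the distance.
  refine ⟨l + 1, by linarith, fun x hx => ?_⟩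
  obtain ⟨v, hv, hd⟩ := (Metric.infDist_lt_iff (hne ⟨x, hx, rfl⟩)).mp
    ((hb x hx).trans_lt (lt_add_one l))
  rw [dist_zero_left] at hd
  exact ⟨v, hv, hd.le⟩

lemma BasicAssumptions.exists_pos_le (hP : P.BasicAssumptions L) :
    ∃ c > 0, ∀ x ∈ P.S, P.A x ∈ effDom P.g → c ≤ (P.g (P.A x)).toReal + P.h x := by
  obtain ⟨c, hc0, hc⟩ := EReal.lt_iff_exists_real_btwn.mp hP.inf_pos
  refine ⟨c, by exact_mod_cast hc0, fun x hx hA => ?_⟩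
  have h1 : (c : EReal) ≤ P.g (P.A x) + (P.h x : EReal) :=
    hc.le.trans (iInf₂_le x hx)
  rw [← hP.g_pcl.proper.coe_toReal hA, ← EReal.coe_add] at h1
  exact_mod_cast h1

/-- The subgradient v at `A x` gives g(Ax - γz) ≥ g(Ax) - γ⟨v, z⟩ ≥ g(Ax) - γl², so smoothing costs
less than the positive lower bound c. -/
lemma BasicAssumptions.psi_pos_of_mul_lt (hP : P.BasicAssumptions L) {x u : Eucl n} {v z : Eucl s}
    {c l δ γ : ℝ} (hγ : 0 < γ) (hδ : 0 ≤ δ)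
    (hc : c ≤ (P.g (P.A x)).toReal + P.h x) (hv : v ∈ convSubdiff P.g (P.A x)) (hvl : ‖v‖ ≤ l)
    (hz : z ∈ convSubdiff P.g (P.A x - γ • z)) (hlc : γ * l ^ 2 < c) :
    0 < P.Psi x z u δ γ := by
  have hg := hP.g_pcl.proper
  have hzv := hg.norm_le_of_mem_convSubdiff_sub_smul hγ hv hz
  have h1 := hg.subgradient_le hv hz.1
  have h2 : P.A x - γ • z - P.A x = -(γ • z) := by abel
  rw [h2, inner_neg_right, inner_smul_right] at h1
  have h3 : ⟪v, z⟫ ≤ l ^ 2 := by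
    refine (real_inner_le_norm v z).trans ?_
    nlinarith [norm_nonneg v, norm_nonneg z]
  have h4 : γ * ⟪v, z⟫ ≤ γ * l ^ 2 := by gcongr
  have h5 : 0 ≤ γ / 2 * ‖z‖ ^ 2 := by positivity
  have h6 : 0 ≤ δ / 2 * ‖x - u‖ ^ 2 := by positivity
  simp only [Psi]
  rw [hg.fenchelConj_toReal hz, inner_sub_right, inner_smul_right, real_inner_self_eq_norm_sq]
  linarith

namespace IsAdaptiveFSPS

variable {β ν q ε : ℝ} {x : ℕ → Eucl n} {y : ℕ → Eucl p} {z : ℕ → Eucl s} {u : ℕ → Eucl n}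
  {θ γ δ : ℕ → ℝ}

lemma x_mem (h : P.IsAdaptiveFSPS L β ν q ε x y z u θ γ δ) : ∀ k, x k ∈ P.S
  | 0 => h.x_zero
  | k + 1 => (h.x_step k).1

lemma exists_γ_eq_pow (h : P.IsAdaptiveFSPS L β ν q ε x y z u θ γ δ) (k : ℕ) :
    ∃ N : ℕ, γ k = q ^ N := by
  induction k with
  | zero => exact ⟨0, by rw [h.γ_zero, pow_zero]⟩
  | succ k ih =>
    obtain ⟨N, hN⟩ := ih
    obtain ⟨j, γ', hγ', -, -, -, hγ⟩ := h.z_step k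
    rw [hN, ← pow_add] at hγ'
    split_ifs at hγ
    · exact ⟨N + j + 1, by rw [hγ, hγ', pow_succ]⟩
    · exact ⟨N + j, by rw [hγ, hγ']⟩

lemma γ_pos (h : P.IsAdaptiveFSPS L β ν q ε x y z u θ γ δ) (hq0 : 0 < q) (k : ℕ) : 0 < γ k := by
  obtain ⟨N, hN⟩ := h.exists_γ_eq_pow k
  rw [hN]
  positivity

lemma δ_pos (h : P.IsAdaptiveFSPS L β ν q ε x y z u θ γ δ) (hν : 0 < ν) (hq0 : 0 < q) :
    ∀ k, 0 < δ k
  | 0 => h.δ_zero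
  | k + 1 => by
    rw [h.δ_step k]
    have h1 := h.γ_pos hq0 (k + 1)
    have h2 := L.coe_nonneg
    have h3 : 0 ≤ 2 * ‖P.A‖ ^ 2 / γ (k + 1) := by positivity
    linarith

/-- The exponents of `q` in the smoothing parameters are eventually constant. -/
lemma exists_γ_eventually_eq (hP : P.BasicAssumptions L) (hsub : P.SubgradientBound)
    (h : P.IsAdaptiveFSPS L β ν q ε x y z u θ γ δ) (hν : 0 < ν) (hq0 : 0 < q) (hq1 : q < 1)
    (hε : 0 < ε) : ∃ k₀, ∀ k, k₀ ≤ k → γ k = γ k₀ := by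
  obtain ⟨l, hl, hbound⟩ := hsub.exists_bound
  obtain ⟨c, hc, hcle⟩ := hP.exists_pos_le
  choose N hN using h.exists_γ_eq_pow
  have hinj := pow_right_injective₀ hq0 hq1.ne
  -- The first threshold makes θ positive, so backtracking stops; the other two make the norm test
  -- pass.
  obtain ⟨N₀, hN₀⟩ := exists_pow_lt_of_lt_one
    (lt_min (by positivity : 0 < c / l ^ 2) (lt_min (by positivity : 0 < ε / l)
      (by positivity : 0 < 2 * ε / l ^ 2))) hq1
  have hsmall : ∀ i, N₀ ≤ i → q ^ i < c / l ^ 2 ∧ q ^ i < ε / l ∧ q ^ i < 2 * ε / l ^ 2 := by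
    intro i hi
    have h1 := (pow_le_pow_of_le_one hq0.le hq1.le hi).trans_lt hN₀
    simpa only [lt_min_iff] using h1
  -- Exponents never decrease, cannot jump past N₀ + 1 from below, and stay fixed from N₀ on; a
  -- bounded monotone sequence of naturals is eventually constant.
  have hstep : ∀ k, N k ≤ N (k + 1) ∧ (N k ≤ N₀ → N (k + 1) ≤ N₀ + 1) ∧
      (N₀ ≤ N k → N (k + 1) = N k) := by
    intro k
    obtain ⟨j, γ', hγ', hleast, hprox, -, hγ⟩ := h.z_step k
    have hxS := h.x_mem (k + 1)
    obtain ⟨v, hv, hvl⟩ := hbound _ hxS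
    have hjle : ∀ i, N₀ ≤ N k + i → j ≤ i := by
      intro i hi
      refine hleast.2 ?_
      have hγi : 0 < γ k * q ^ i := mul_pos (h.γ_pos hq0 k) (pow_pos hq0 i)
      obtain ⟨w, hw⟩ := hP.g_pcl.exists_mem_convSubdiff_sub_smul hv hγi
      refine ⟨w, hP.g_pcl.proper.isProx_of_mem_convSubdiff hγi hw, ?_⟩
      refine div_pos (hP.psi_pos_of_mul_lt hγi (h.δ_pos hν hq0 k).le
        (hcle _ hxS hv.1) hv hvl hw ?_) (hP.f_toReal_pos hxS)
      rw [hN k, ← pow_add]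
      exact (lt_div_iff₀ (by positivity)).mp (hsmall _ hi).1
    rw [hN k, ← pow_add] at hγ'
    have hγ'0 : 0 < γ' := hγ' ▸ pow_pos hq0 _
    have hz := hP.g_pcl.mem_convSubdiff_of_isProx hv hγ'0 hprox
    have hzl := (hP.g_pcl.proper.norm_le_of_mem_convSubdiff_sub_smul hγ'0 hv hz).trans hvl
    have hNsucc : N (k + 1) = N k + j + 1 ∧ ¬ N₀ ≤ N k + j ∨ N (k + 1) = N k + j := by
      split_ifs at hγ with hif
      · refine Or.inl ⟨hinj ?_, fun hle => ?_⟩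
        · simp only
          rw [← hN (k + 1), hγ, hγ', pow_succ]
        · obtain ⟨-, h1, h2⟩ := hsmall _ hle
          rw [← hγ'] at h1 h2
          refine absurd (hzl.trans (le_min ?_ ?_)) (not_le.mpr hif)
          · rw [le_div_iff₀ hγ'0]
            rw [lt_div_iff₀ hl] at h1
            linarith
          · refine Real.le_sqrt_of_sq_le ?_
            rw [le_div_iff₀ hγ'0]
            rw [lt_div_iff₀ (by positivity)] at h2
            linarith
      · refine Or.inr (hinj ?_)
        simp only
        rw [← hN (k + 1), hγ, hγ']
    refine ⟨by omega, fun hle => ?_, fun hle => ?_⟩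
    · have := hjle (N₀ - N k) (by omega)
      omega
    · have := hjle 0 (by omega)
      omega
  have hmono : Monotone N := monotone_nat_of_le_succ fun k => (hstep k).1
  have hbdd : ∀ k, N k ≤ max (N 0) (N₀ + 1) := by
    intro k
    induction k with
    | zero => exact le_max_left _ _
    | succ k ih =>
      obtain ⟨-, h1, h2⟩ := hstep k
      rcases le_total (N k) N₀ with hle | hle
      · exact (h1 hle).trans (le_max_right _ _)
      · rwa [h2 hle]
  obtain ⟨k₀, hk₀⟩ := Nat.sSup_mem (range_nonempty N)
    ⟨_, by rintro _ ⟨k, rfl⟩; exact hbdd k⟩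
  refine ⟨k₀, fun k hk => ?_⟩
  have h1 : N k ≤ N k₀ := hk₀ ▸ le_csSup
    ⟨_, by rintro _ ⟨k, rfl⟩; exact hbdd k⟩ (mem_range_self k)
  rw [hN k, hN k₀, le_antisymm h1 (hmono hk)]

/-- Constancy of γ excludes both kinds of reduction. The tail starts at k₀ + 2 because θ (k + 1) is
computed with δ k, which has its final form only for k ≥ k₀ + 1. -/
lemma steadyFSPS_tail (hP : P.BasicAssumptions L) (hsub : P.SubgradientBound)
    (h : P.IsAdaptiveFSPS L β ν q ε x y z u θ γ δ) (hq0 : 0 < q) (hq1 : q < 1)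
    {k₀ : ℕ} (hk₀ : ∀ k, k₀ ≤ k → γ k = γ k₀) :
    P.SteadyFSPS β (2 * ν + L + 2 * ‖P.A‖ ^ 2 / γ k₀) (γ k₀) ε (fun k => x (k + (k₀ + 2)))
      (fun k => y (k + (k₀ + 2))) (fun k => z (k + (k₀ + 2))) (fun k => u (k + (k₀ + 2)))
      (fun k => θ (k + (k₀ + 2))) := by
  obtain ⟨l, -, hbound⟩ := hsub.exists_bound
  have hγ0 := h.γ_pos hq0 k₀
  have hδ : ∀ k, k₀ ≤ k → δ (k + 1) = 2 * ν + L + 2 * ‖P.A‖ ^ 2 / γ k₀ := fun k hk => by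
    rw [h.δ_step k, hk₀ (k + 1) (by omega)]
  have hz : ∀ k, k₀ ≤ k → z (k + 1) ∈ convSubdiff P.g (P.A (x (k + 1)) - γ k₀ • z (k + 1)) ∧
      ‖z (k + 1)‖ ≤ min (ε / γ k₀) (√(2 * ε / γ k₀)) ∧
      θ (k + 1) = P.Psi (x (k + 1)) (z (k + 1)) (u (k + 1)) (δ k) (γ k₀) /
        (P.f (P.K (x (k + 1)))).toReal ∧ 0 < θ (k + 1) := by
    intro k hk
    obtain ⟨j, γ', hγ', hleast, hprox, hθ, hγ⟩ := h.z_step k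
    obtain ⟨v, hv, -⟩ := hbound _ (h.x_mem (k + 1))
    rw [hk₀ k hk] at hγ' hleast
    rw [hk₀ (k + 1) (by omega)] at hγ
    have hq : γ' ≤ γ k₀ := by
      rw [hγ']
      exact mul_le_of_le_one_right hγ0.le (pow_le_one₀ hq0.le hq1.le)
    have hγ'0 : 0 < γ' := hγ' ▸ mul_pos hγ0 (pow_pos hq0 j)
    have hif : ¬ min (ε / γ') (√(2 * ε / γ')) < ‖z (k + 1)‖ := by
      intro hif
      rw [if_pos hif] at hγ
      nlinarith
    rw [if_neg hif] at hγ
    have hj : γ k₀ * q ^ j = γ k₀ := by rw [← hγ', ← hγ]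
    obtain ⟨w, hw, hpos⟩ := hleast.1
    subst hγ
    have hzm := hP.g_pcl.mem_convSubdiff_of_isProx hv hγ0 hprox
    rw [hj] at hw hpos
    -- Positivity in the line search is known for some proximal point; uniqueness identifies it with
    -- z (k + 1).
    have hwz := hP.g_pcl.proper.eq_of_isProx hγ0 hzm hw
    rw [hwz, ← hθ] at hpos
    exact ⟨hzm, not_lt.mp hif, hθ, hpos⟩
  have hz' : ∀ k, z (k + (k₀ + 2)) ∈
      convSubdiff P.g (P.A (x (k + (k₀ + 2))) - γ k₀ • z (k + (k₀ + 2))) ∧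
      ‖z (k + (k₀ + 2))‖ ≤ min (ε / γ k₀) (√(2 * ε / γ k₀)) ∧
      θ (k + (k₀ + 2)) = P.Psi (x (k + (k₀ + 2))) (z (k + (k₀ + 2))) (u (k + (k₀ + 2)))
        (2 * ν + L + 2 * ‖P.A‖ ^ 2 / γ k₀) (γ k₀) / (P.f (P.K (x (k + (k₀ + 2))))).toReal ∧
      0 < θ (k + (k₀ + 2)) := fun k => by
    have := hz (k + k₀ + 1) (by omega)
    rwa [hδ (k + k₀) (by omega)] at this
  refine ⟨fun k => h.x_mem _, fun k => ?_, fun k => ?_, fun k => ?_, fun k => (hz' k).1,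
    fun k => ?_, fun k => ?_, fun k => (hz' k).2.2.1, fun k => (hz' k).2.2.2⟩
  · simpa only [Nat.add_right_comm k (k₀ + 2) 1] using h.y_step (k + (k₀ + 2))
  · have := h.x_step (k + (k₀ + 2))
    rw [show δ (k + (k₀ + 2)) = _ from hδ (k + k₀ + 1) (by omega)] at this
    simpa only [Nat.add_right_comm k (k₀ + 2) 1] using this
  · simpa only [Nat.add_right_comm k (k₀ + 2) 1] using h.u_step (k + (k₀ + 2))
  · have h1 := (hz' k).2.1.trans (min_le_left _ _)
    rw [le_div_iff₀ hγ0] at h1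
    linarith
  · have h1 := (hz' k).2.1.trans (min_le_right _ _)
    have h2 := Real.le_sqrt' (x := ‖z (k + (k₀ + 2))‖) (y := 2 * ε / γ k₀)
    rcases (norm_nonneg (z (k + (k₀ + 2)))).eq_or_lt with h0 | h0
    · have h3 := h1.trans' h0.le
      have h4 := (hz' k).2.1.trans (min_le_left _ _)
      rw [← h0, le_div_iff₀ hγ0, zero_mul] at h4
      rw [← h0]
      linarith
    · have h3 := (h2 h0).mp h1
      rw [le_div_iff₀ hγ0] at h3
      linarith

end IsAdaptiveFSPS

end FracProgram

/-! ### The global convergence theorem. -/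

theorem theorem6p7 {n p s : ℕ} (P : FracProgram n p s) (L : ℝ≥0)
    (hP : P.BasicAssumptions L) (hsub : P.SubgradientBound)
    (β ν q ε : ℝ) (hβ0 : 0 < β) (hβ2 : β < 2) (hν : 0 < ν) (hq0 : 0 < q) (hq1 : q < 1) (hε : 0 < ε)
    (hKeps : P.Keps ε ⊆ interior (effDom P.g))
    (hg : IsEssStrictConvex P.g)
    (x : ℕ → Eucl n) (y : ℕ → Eucl p) (z : ℕ → Eucl s) (u : ℕ → Eucl n) (θ γ δ : ℕ → ℝ)
    (halg : P.IsAdaptiveFSPS L β ν q ε x y z u θ γ δ)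
    (hcase :
      ((∀ v ∈ effDom (fenchelConj P.f), IsCalmAt (fenchelConj P.f) v) ∧
        ∃ m : ℝ, 0 < m ∧ (∀ k, (m : EReal) < P.f (P.K (x k))) ∧
          ∀ γ' : ℝ, (∀ᶠ k in atTop, γ k = γ') →
            ∀ w ∈ domLimitingSubdiff (P.GammaMerit m (2 * ν + L + 2 * ‖P.A‖ ^ 2 / γ') γ'),
              P.A w.fst ∈ P.Keps ε →
                HasKLAt (P.GammaMerit m (2 * ν + L + 2 * ‖P.A‖ ^ 2 / γ') γ') w) ∨
      (HasLipschitzGradientNear P.f (P.K '' P.S) ∧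
        ∀ γ' : ℝ, (∀ᶠ k in atTop, γ k = γ') →
          ∀ w ∈ domLimitingSubdiff (P.PiMerit (2 * ν + L + 2 * ‖P.A‖ ^ 2 / γ') γ'),
            P.A w.fst ∈ P.Keps ε →
              HasKLAt (P.PiMerit (2 * ν + L + 2 * ‖P.A‖ ^ 2 / γ') γ') w)) :
    Summable (fun k => ‖x k - x (k + 1)‖ + ‖u k - u (k + 1)‖ + ‖z k - z (k + 1)‖) ∧
    ∃ xbar : Eucl n, Tendsto x atTop (𝓝 xbar) ∧
      (∃ κ : ℝ≥0, 0 < κ ∧ LipschitzOnWith κ (fun w => (P.g w).toReal) (P.Keps ε)) ∧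
      (∀ κ : ℝ≥0, LipschitzOnWith κ (fun w => (P.g w).toReal) (P.Keps ε) →
        P.IsLiftedStationary (2 * κ * ε) ((2 * κ + 1) * ε) xbar) ∧
      (∀ Lg : ℝ≥0, 0 < Lg → (∀ w, P.g w ≠ ⊤) →
        Differentiable ℝ (fun w => (P.g w).toReal) →
        LipschitzWith Lg (gradient (fun w => (P.g w).toReal)) →
          P.IsLiftedStationary (Lg * ε ^ 2 / 2) (Lg * ε ^ 2 / 2 + ε) xbar) := by
  obtain ⟨k₀, hk₀⟩ := halg.exists_γ_eventually_eq hP hsub hν hq0 hq1 hε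
  have hst := halg.steadyFSPS_tail hP hsub hq0 hq1 hk₀
  have hγ0 := halg.γ_pos hq0 k₀
  have hev : ∀ᶠ k in atTop, γ k = γ k₀ := eventually_atTop.mpr ⟨k₀, hk₀⟩
  have hδ0 : 0 < 2 * ν + L + 2 * ‖P.A‖ ^ 2 / γ k₀ := by
    have := L.coe_nonneg
    have : 0 ≤ 2 * ‖P.A‖ ^ 2 / γ k₀ := by positivity
    linarith
  have hsum : Summable (FracProgram.stepLength (fun k => x (k + (k₀ + 2)))
      (fun k => u (k + (k₀ + 2))) (fun k => z (k + (k₀ + 2)))) := by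
    rcases hcase with ⟨-, m, hm, hmf, hKL⟩ | ⟨hlip, hKL⟩
    · refine hst.summable_of_gammaMerit hP hg hγ0 hβ0 hβ2 hν rfl hε hm (fun k => ?_) (hKL _ hev)
      have h1 := hmf (k + (k₀ + 2))
      rw [← hP.f_pcl.proper.coe_toReal (hP.mem_effDom_f (halg.x_mem _))] at h1
      exact_mod_cast h1
    · exact hst.summable_of_piMerit hP hg hγ0 hβ0 hβ2 hν rfl hε hlip (hKL _ hev)
  obtain ⟨xbar, ybar, zbar, hx, hlim⟩ := hst.exists_limit hP hβ0.ne' hδ0 hsum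
  have hA : P.A xbar ∈ effDom P.g :=
    interior_subset (hKeps (FracProgram.map_mem_Keps hε.le hlim.x_mem))
  refine ⟨?_, xbar, (tendsto_add_atTop_iff_nat (k₀ + 2)).mp hx,
    hP.exists_lipschitzOnWith_Keps hKeps,
    fun κ hκ => hlim.isLiftedStationary_of_lipschitzOnWith hP hγ0 hε hA hκ,
    fun Lg _ hfin hd hL => hlim.isLiftedStationary_of_lipschitzWith_gradient hP hγ0 hfin hd hL⟩
  rw [← summable_nat_add_iff (k₀ + 2)]
  refine hsum.congr fun k => ?_
  simp only [FracProgram.stepLength, Nat.add_right_comm k (k₀ + 2) 1]
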